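/- Let $r\ge 1$ be an integer, let $\nu_1,\dots,\nu_r\ge 0$ be arbitrary integers, and for $n\ge 1$ let $$F_n(x)=\sum_{k=0}^{n}\binom{n}{k}\frac{(-x)^k}{(k+\nu_1)!\cdots(k+\nu_r)!}.$$ All zeros of the degree-$n$ polynomial $x\mapsto F_n(n^r x)$ are real; let $x_{n1}\le\dots\le x_{nn}$ be these zeros, counted with multiplicity, and let $\mu_n=\frac1n\sum_{k=1}^n\delta_{x_{nk}}$ be its normalized zero-counting measure. Put $x^\ast=\frac{(r+1)^{r+1}}{r^r}$ and, for $0<\varphi<\frac{\pi}{r+1}$, $$\rho(\varphi)=\frac{(\sin (r+1)\varphi)^{r+1}}{\sin\varphi\,(\sin r\varphi)^r},\qquad f(\varphi)=(r+1)\varphi-r\,\frac{\sin (r+1)\varphi}{\sin r\varphi}\,\sin\varphi .$$ Then $\rho$ is a bijection from $\left(0,\frac{\pi}{r+1}\right)$ onto $(0,x^\ast)$, and the sequence $(\mu_n)_{n\ge1}$ converges weak-star (that is, $\int g\,d\mu_n\to\int g\,d\mu$ for every bounded continuous $g:\mathbb R\to\mathbb R$) to a probability measure $\mu$ supported on $[0,x^\ast]$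 whose distribution function $V(x)=\mu((-\infty,x])$ is $$V(x)=\begin{cases}0,& x\le 0,\\ 1-\frac1\pi f(\rho^{-1}(x)),& 0<x<x^\ast,\\ 1,& x\ge x^\ast.\end{cases}$$ Moreover, $\mu$ is the Fuss–Catalan distribution of order $r$, i.e. the unique probability measure on $\mathbb R$ whose $k$-th moment is the Fuss–Catalan number $\frac{1}{rk+1}\binom{rk+k}{k}$ for every integer $k\ge 0$. -/

import Mathlib

open MeasureTheory ProbabilityTheory Filter Topology Polynomial

noncomputable section

namespace GinibreZeros

/-- The polynomial `F_n(x) = ∑_{k=0}^n (n choose k) (-x)^k / ((k+ν_1)! ⋯ (k+ν_r)!)`. -/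
def F (r : ℕ) (ν : Fin r → ℕ) (n : ℕ) : ℝ[X] :=
  ∑ k ∈ Finset.range (n + 1),
    C ((n.choose k : ℝ) / ∏ j, ((k + ν j).factorial : ℝ)) * (-X) ^ k

/-- The rescaled polynomial `F_n(n^r x)`. -/
def scaledF (r : ℕ) (ν : Fin r → ℕ) (n : ℕ) : ℝ[X] :=
  (F r ν n).comp (C ((n : ℝ) ^ r) * X)

/-- The normalized zero counting measure on the real line of a real polynomial `p`:
`1 / deg p` times the sum of the Dirac measures at the real zeros of `p`, taken with multiplicity.
It has total mass one exactly when `p` is non-constant and all its complex zeros are real. -/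
def zeroCountingMeasure (p : ℝ[X]) : Measure ℝ :=
  (p.natDegree : ENNReal)⁻¹ • (p.roots.map fun x => Measure.dirac x).sum

/-- The right endpoint `(r+1)^(r+1) / r^r`. -/
def xStar (r : ℕ) : ℝ := ((r : ℝ) + 1) ^ (r + 1) / (r : ℝ) ^ r

/-- The parameter interval `(0, π/(r+1))`. -/
def paramInterval (r : ℕ) : Set ℝ := Set.Ioo 0 (Real.pi / ((r : ℝ) + 1))

/-- `ρ(φ) = sin((r+1)φ)^(r+1) / (sin φ · sin(rφ)^r)`. -/
def rho (r : ℕ) (φ : ℝ) : ℝ :=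
  Real.sin (((r : ℝ) + 1) * φ) ^ (r + 1) / (Real.sin φ * Real.sin ((r : ℝ) * φ) ^ r)

/-- `f(φ) = (r+1)φ - r · (sin((r+1)φ) / sin(rφ)) · sin φ`. -/
def f (r : ℕ) (φ : ℝ) : ℝ :=
  ((r : ℝ) + 1) * φ
    - r * (Real.sin (((r : ℝ) + 1) * φ) / Real.sin ((r : ℝ) * φ)) * Real.sin φ

/-- The inverse of `ρ : (0, π/(r+1)) → (0, (r+1)^(r+1)/r^r)`. -/
def rhoInv (r : ℕ) (x : ℝ) : ℝ := Function.invFunOn (rho r) (paramInterval r) x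

/-- The distribution function `V`. -/
def V (r : ℕ) (x : ℝ) : ℝ :=
  if x ≤ 0 then 0
  else if x < xStar r then 1 - (1 / Real.pi) * f r (rhoInv r x)
  else 1

/-- `μ` is the Fuss-Catalan distribution of order `r`: the probability measure on the real line
whose `k`-th moment is, for every `k`, the Fuss-Catalan number `binom(rk+k, k) / (rk+1)`. -/
def IsFussCatalan (r : ℕ) (μ : ProbabilityMeasure ℝ) : Prop :=
  ∀ k : ℕ, Integrable (fun x : ℝ => x ^ k) (μ : Measure ℝ) ∧
    ∫ x, x ^ k ∂(μ : Measure ℝ) = ((r * k + k).choose k : ℝ) / ((r : ℝ) * k + 1)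

end GinibreZeros

end

/-!
The proof is by the method of moments.

*Real zeros.* By Rolle's theorem applied to `e ^ {-ax} R(x)`, the operator `D - a` preserves
real-rootedness, hence so does `q(D)` for every real-rooted `q` (`splits_aeval_derivative`). Applied
to `X ^ (n + ν)`, with `q` the reverse of a polynomial `∑ p_k X ^ k`, this shows that
`∑ p_k X ^ k / (k + ν)!` is real-rooted; `F_n` arises in `r` such steps from `(1 - X) ^ n`.

*Moments of the zeros.* Let `W_n(t)` be the generating series of the moments of the zero counting
measure. By logarithmic differentiation of `Q = ∏ (1 - x_{nk} t)`, multiplication by `Q` conjugates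
the operator `1 + ν / n - θ / n`, `θ = t d/dt`, into `L_ν Y = W_n Y + (ν / n) Y - θ Y / n`. The
hypergeometric equation of `F_n` thereby becomes `W_n = 1 + t L_{ν_1} ⋯ L_{ν_r} W_n`
(`momentSeries_eq`), which tends coefficientwise to `W = 1 + t W ^ (r + 1)`. The coefficients of
the solution `W` are the Fuss–Catalan numbers, whatever the `ν_j` are.

*The limit measure.* It is defined as the image under `ρ` of the measure with density `f' / π` on
`(0, π / (r + 1))`. Here `f'` is a sum of two squares (`weight`), and `ρ` is strictly decreasing
because its logarithmic derivative is, up to a positive factor, minus such a sum; this gives the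
distribution function. For the moments, put `u = (sin φ / sin (r φ)) e ^ {i (r + 1) φ}`. Then
`ρ = (1 + u) ^ (r + 1) / u` and `f' dφ = Im ((1 / u - r) du)`, so `ρ ^ k f' dφ` is the imaginary
part of a Laurent polynomial in `u` times `du`. The curve has real endpoints `1 / r` and `-1`, so
that only the residue term contributes to the integral: the `k`-th moment is the coefficient of
`u ^ k` in `(1 + u) ^ ((r + 1) k) (1 - r u)`, again a Fuss–Catalan number
(`moment_fussCatalanMeasure`).

*Convergence.* Since the limit has compact support, its characteristic function is the sum of its
moment series; Taylor's formula with remainder at an even order shows that convergence of the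
moments implies that of the characteristic functions, and Lévy's continuity theorem applies
(`tendsto_of_tendsto_moments`). For a constant sequence this is the uniqueness of the measure with
the given moments.
-/

noncomputable section

namespace GinibreZeros

/-! ### Real-rootedness -/

/-- Rolle's theorem for `e^{-ax} R(x)`, whose derivative is `e^{-ax} (R' - aR)(x)`. -/
theorem card_roots_toFinset_le_derivative_sub_C_mul {R : ℝ[X]} (a : ℝ)
    (hZ : derivative R - C a * R ≠ 0) :
    R.roots.toFinset.card ≤
      ((derivative R - C a * R).roots.toFinset \ R.roots.toFinset).card + 1 := by
  have hR : R ≠ 0 := by rintro rfl; simp at hZ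
  refine Finset.card_le_sdiff_of_interleaved fun x hx y hy hxy hxy' => ?_
  rw [Multiset.mem_toFinset, mem_roots hR] at hx hy
  have hd : ∀ z : ℝ, HasDerivAt (fun z => Real.exp (-a * z) * R.eval z)
      (Real.exp (-a * z) * (derivative R - C a * R).eval z) z := by
    intro z
    have h1 : HasDerivAt (fun z : ℝ => -a * z) (-a) z := by
      simpa using (hasDerivAt_id z).const_mul (-a)
    refine (h1.exp.mul (R.hasDerivAt z)).congr_deriv ?_
    simp only [eval_sub, eval_mul, eval_C]
    ring
  obtain ⟨z, hz1, hz2⟩ := exists_deriv_eq_zero hxy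
    (fun z _ => (hd z).continuousAt.continuousWithinAt)
    (by rw [hx.eq_zero, hy.eq_zero, mul_zero, mul_zero])
  refine ⟨z, ?_, hz1⟩
  rw [(hd z).deriv] at hz2
  rw [Multiset.mem_toFinset, mem_roots hZ]
  exact (mul_eq_zero.1 hz2).resolve_left (Real.exp_pos _).ne'

/-- `R' - aR` loses at most one root, counted with multiplicities: a root of `R` of multiplicity `m`
is one of multiplicity at least `m - 1`, and the roots between those of `R` come from Rolle's
theorem. -/
theorem card_roots_le_derivative_sub_C_mul {R : ℝ[X]} (a : ℝ)
    (hZ : derivative R - C a * R ≠ 0) :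
    Multiset.card R.roots ≤ Multiset.card (derivative R - C a * R).roots + 1 := by
  set Z := derivative R - C a * R with hZdef
  have hmult : ∀ x, R.rootMultiplicity x - 1 ≤ Z.rootMultiplicity x := by
    intro x
    rw [le_rootMultiplicity_iff hZ]
    refine dvd_sub ?_ ?_
    · by_cases hd : derivative R = 0
      · simp [hd]
      · exact (le_rootMultiplicity_iff hd).1
          (rootMultiplicity_sub_one_le_derivative_rootMultiplicity _ _)
    · exact ((pow_dvd_pow _ (Nat.sub_le _ _)).trans (pow_rootMultiplicity_dvd R x)).mul_left _
  calc
    Multiset.card R.roots = ∑ x ∈ R.roots.toFinset, R.roots.count x :=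
      (Multiset.toFinset_sum_count_eq _).symm
    _ = ∑ x ∈ R.roots.toFinset, (R.roots.count x - 1 + 1) :=
      (Eq.symm <| Finset.sum_congr rfl fun _ hx => tsub_add_cancel_of_le <|
        Nat.succ_le_iff.2 <| Multiset.count_pos.2 <| Multiset.mem_toFinset.1 hx)
    _ = (∑ x ∈ R.roots.toFinset, (R.rootMultiplicity x - 1)) + R.roots.toFinset.card := by
      simp only [Finset.sum_add_distrib, Finset.card_eq_sum_ones, count_roots]
    _ ≤ (∑ x ∈ R.roots.toFinset, Z.rootMultiplicity x) +
          ((Z.roots.toFinset \ R.roots.toFinset).card + 1) :=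
      add_le_add (Finset.sum_le_sum fun x _ => hmult x)
        (card_roots_toFinset_le_derivative_sub_C_mul a hZ)
    _ ≤ (∑ x ∈ R.roots.toFinset, Z.roots.count x) +
          ((∑ x ∈ Z.roots.toFinset \ R.roots.toFinset, Z.roots.count x) + 1) := by
      simp only [← count_roots, Finset.card_eq_sum_ones]
      gcongr with x hx
      rw [Nat.succ_le_iff, Multiset.count_pos, ← Multiset.mem_toFinset]
      exact (Finset.mem_sdiff.1 hx).1
    _ = Multiset.card Z.roots + 1 := by
      rw [← add_assoc, ← Finset.sum_union Finset.disjoint_sdiff, Finset.union_sdiff_self_eq_union, ←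
        Multiset.toFinset_sum_count_eq, ← Finset.sum_subset Finset.subset_union_right]
      intro x _ hx₂
      simpa only [Multiset.mem_toFinset, Multiset.count_eq_zero] using hx₂

/-- After division by the linear factors of the roots, a factor of degree at most one is left. -/
theorem splits_of_natDegree_le_card_roots_add_one {K : Type*} [Field K] {Z : K[X]}
    (h : Z.natDegree ≤ Multiset.card Z.roots + 1) : Z.Splits := by
  obtain ⟨q, hq, hdeg, -⟩ := exists_prod_multiset_X_sub_C_mul Z
  rw [← hq]
  refine (Splits.multisetProd fun f hf => ?_).mul (Splits.of_natDegree_le_one (by omega))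
  obtain ⟨a, -, rfl⟩ := Multiset.mem_map.1 hf
  exact Splits.X_sub_C a

/-- The operator `D - a` preserves real-rootedness. -/
theorem splits_derivative_sub_C_mul {R : ℝ[X]} (hR : R.Splits) (a : ℝ) :
    (derivative R - C a * R).Splits := by
  by_cases hZ : derivative R - C a * R = 0
  · rw [hZ]; exact Splits.zero
  refine splits_of_natDegree_le_card_roots_add_one ?_
  refine le_trans ?_ (card_roots_le_derivative_sub_C_mul a hZ)
  rw [← hR.natDegree_eq_card_roots]
  refine (natDegree_sub_le _ _).trans (max_le ?_ (natDegree_C_mul_le _ _))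
  exact (natDegree_derivative_le R).trans (Nat.sub_le _ _)

/-- **Hermite–Poulain theorem**: if `q` and `R` are real-rooted, then so is `q(D) R`. -/
theorem splits_aeval_derivative {q R : ℝ[X]} (hq : q.Splits) (hR : R.Splits) :
    (aeval (derivative : ℝ[X] →ₗ[ℝ] ℝ[X]) q R).Splits := by
  rw [hq.eq_prod_roots]
  generalize q.leadingCoeff = c
  generalize q.roots = s
  rw [map_mul, aeval_C, Module.algebraMap_end_eq_smul_id, Module.End.mul_apply,
    LinearMap.smul_apply, LinearMap.id_apply, smul_eq_C_mul]
  refine Splits.C_mul ?_ c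
  induction s using Multiset.induction with
  | empty => simpa using hR
  | cons a s ih =>
    rw [Multiset.map_cons, Multiset.prod_cons, map_mul, Module.End.mul_apply]
    convert splits_derivative_sub_C_mul ih a using 1
    simp [Module.algebraMap_end_eq_smul_id, smul_eq_C_mul]

theorem splits_reverse {p : ℝ[X]} (hp : p.Splits) : p.reverse.Splits := by
  rw [hp.eq_prod_roots, reverse_mul_of_domain, reverse_C]
  refine Splits.C_mul ?_ _
  generalize p.roots = s
  induction s using Multiset.induction with
  | empty =>
    rw [Multiset.map_zero, Multiset.prod_zero]
    exact Splits.of_natDegree_eq_zero (Nat.le_zero.1 ((reverse_natDegree_le _).trans (by simp)))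
  | cons a s ih =>
    rw [Multiset.map_cons, Multiset.prod_cons, reverse_mul_of_domain]
    refine Splits.mul (Splits.of_natDegree_le_one ?_) ih
    exact (reverse_natDegree_le _).trans (natDegree_X_sub_C a).le

/-- The sequence `1 / (k + ν)!` is a multiplier sequence: applying the reversed polynomial of `p`,
as a differential operator, to `X ^ (n + ν)` gives `(n + ν)! X ^ ν ∑ p_k X ^ k / (k + ν)!`. -/
theorem splits_sum_div_factorial {n : ℕ} {a : ℕ → ℝ} (h0 : a 0 ≠ 0) (hn : a n ≠ 0) (ν : ℕ)
    (ha : (∑ k ∈ Finset.range (n + 1), C (a k) * X ^ k : ℝ[X]).Splits) :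
    (∑ k ∈ Finset.range (n + 1), C (a k / ((k + ν).factorial : ℝ)) * X ^ k : ℝ[X]).Splits := by
  set p : ℝ[X] := ∑ k ∈ Finset.range (n + 1), C (a k) * X ^ k with hp
  have hcoeff : ∀ k, p.coeff k = if k ≤ n then a k else 0 := by
    intro k
    simp [hp]
  have hdeg : p.natDegree = n := by
    refine natDegree_eq_of_le_of_coeff_ne_zero ?_ ?_
    · exact natDegree_le_iff_coeff_eq_zero.2 fun k hk => by rw [hcoeff, if_neg (by omega)]
    · rw [hcoeff, if_pos le_rfl]; exact hn
  have hs := splits_aeval_derivative (splits_reverse ha) (Splits.X_pow (n + ν))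
  have key : aeval (derivative : ℝ[X] →ₗ[ℝ] ℝ[X]) p.reverse (X ^ (n + ν)) =
      C ((n + ν).factorial : ℝ) * X ^ ν *
        ∑ k ∈ Finset.range (n + 1), C (a k / ((k + ν).factorial : ℝ)) * X ^ k := by
    rw [aeval_eq_sum_range' (n := n + 1)
      (Nat.lt_succ_of_le ((reverse_natDegree_le p).trans hdeg.le)), LinearMap.sum_apply,
      ← Finset.sum_range_reflect, Finset.mul_sum]
    refine Finset.sum_congr rfl fun k hk => ?_
    have hk : k ≤ n := Nat.lt_succ_iff.1 (Finset.mem_range.1 hk)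
    rw [show n + 1 - 1 - k = n - k by omega, LinearMap.smul_apply, Module.End.pow_apply,
      iterate_derivative_X_pow_eq_C_mul, coeff_reverse, hdeg, revAt_le (Nat.sub_le _ _),
      Nat.sub_sub_self hk, hcoeff, if_pos hk, smul_eq_C_mul,
      show n + ν - (n - k) = k + ν by omega]
    have hfac : ((n + ν).descFactorial (n - k) : ℝ) = (n + ν).factorial / (k + ν).factorial := by
      rw [eq_div_iff (by exact_mod_cast (k + ν).factorial_ne_zero), mul_comm,
        show k + ν = n + ν - (n - k) by omega]
      exact_mod_cast Nat.factorial_mul_descFactorial (show n - k ≤ n + ν by omega)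
    rw [hfac, pow_add, div_eq_mul_inv, div_eq_mul_inv, C_mul, C_mul]
    ring
  rw [key] at hs
  have hne :
      (∑ k ∈ Finset.range (n + 1), C (a k / ((k + ν).factorial : ℝ)) * X ^ k : ℝ[X]) ≠ 0 := by
    intro h
    have := congrArg (fun q : ℝ[X] => q.coeff 0) h
    simp [h0, Nat.factorial_ne_zero] at this
  refine hs.of_dvd (mul_ne_zero (mul_ne_zero ?_ (pow_ne_zero _ X_ne_zero)) hne) (dvd_mul_left _ _)
  rw [Ne, C_eq_zero]
  exact_mod_cast (n + ν).factorial_ne_zero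

theorem splits_sum_div_prod_factorial (n : ℕ) (l : List ℕ) :
    (∑ k ∈ Finset.range (n + 1),
      C ((-1) ^ k * (n.choose k : ℝ) / (l.map fun ν => ((k + ν).factorial : ℝ)).prod) * X ^ k :
        ℝ[X]).Splits := by
  induction l with
  | nil =>
    have : (∑ k ∈ Finset.range (n + 1),
        C ((-1) ^ k * (n.choose k : ℝ) /
          (([] : List ℕ).map fun ν => ((k + ν).factorial : ℝ)).prod) * X ^ k :
        ℝ[X]) = (C (-1) * X + 1) ^ n := by
      rw [add_pow]
      refine Finset.sum_congr rfl fun k _ => ?_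
      simp
      ring
    rw [this]
    refine Splits.pow (Splits.of_natDegree_le_one ?_) n
    compute_degree
  | cons ν l ih =>
    have hl : ∀ k, (l.map fun ν => ((k + ν).factorial : ℝ)).prod ≠ 0 := by
      intro k
      rw [Ne, List.prod_eq_zero_iff]
      simp [Nat.factorial_ne_zero]
    convert splits_sum_div_factorial (ν := ν) ?_ ?_ ih using 1
    · refine Finset.sum_congr rfl fun k _ => ?_
      rw [List.map_cons, List.prod_cons, div_div, mul_comm ((k + ν).factorial : ℝ)]
    · simp [Nat.factorial_ne_zero]
    · have := hl n
      simp [Nat.factorial_ne_zero]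

/-! ### The polynomials `F_n(n ^ r x)` and their zero counting measures -/

theorem F_eq (r : ℕ) (ν : Fin r → ℕ) (n : ℕ) :
    F r ν n = ∑ k ∈ Finset.range (n + 1),
      C ((-1) ^ k * (n.choose k : ℝ) / ∏ j, ((k + ν j).factorial : ℝ)) * X ^ k := by
  refine Finset.sum_congr rfl fun k _ => ?_
  rw [neg_pow, mul_div_assoc, C_mul, C_pow]
  simp
  ring

theorem splits_F (r : ℕ) (ν : Fin r → ℕ) (n : ℕ) : (F r ν n).Splits := by
  rw [F_eq]
  convert splits_sum_div_prod_factorial n (List.ofFn ν) using 4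
  simp [List.map_ofFn, List.prod_ofFn, Function.comp_def]

theorem coeff_scaledF (r : ℕ) (ν : Fin r → ℕ) (n k : ℕ) :
    (scaledF r ν n).coeff k =
      (-1) ^ k * (n.choose k : ℝ) / (∏ j, ((k + ν j).factorial : ℝ)) * ((n : ℝ) ^ r) ^ k := by
  rw [scaledF, comp_C_mul_X_coeff, F_eq]
  congr 1
  simp only [finsetSum_coeff, coeff_C_mul, coeff_X_pow]
  simp only [mul_ite, mul_one, mul_zero, Finset.sum_ite_eq, Finset.mem_range]
  split_ifs with h
  · rfl
  · rw [Nat.choose_eq_zero_of_lt (by omega)]; simp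

theorem natDegree_scaledF (r : ℕ) (ν : Fin r → ℕ) {n : ℕ} (hn : 1 ≤ n) :
    (scaledF r ν n).natDegree = n := by
  refine natDegree_eq_of_le_of_coeff_ne_zero ?_ ?_
  · refine natDegree_le_iff_coeff_eq_zero.2 fun k hk => ?_
    rw [coeff_scaledF, Nat.choose_eq_zero_of_lt hk]
    simp
  · rw [coeff_scaledF]
    have : ∏ j, ((n + ν j).factorial : ℝ) ≠ 0 :=
      Finset.prod_ne_zero_iff.2 fun j _ => by exact_mod_cast Nat.factorial_ne_zero _
    have : (n : ℝ) ≠ 0 := by positivity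
    simp_all

theorem splits_scaledF (r : ℕ) (ν : Fin r → ℕ) (n : ℕ) : (scaledF r ν n).Splits :=
  (splits_F r ν n).comp_of_natDegree_le_one (by compute_degree)

theorem card_roots_scaledF (r : ℕ) (ν : Fin r → ℕ) {n : ℕ} (hn : 1 ≤ n) :
    Multiset.card (scaledF r ν n).roots = n := by
  rw [← (splits_scaledF r ν n).natDegree_eq_card_roots, natDegree_scaledF r ν hn]

theorem isProbabilityMeasure_zeroCountingMeasure {p : ℝ[X]} (hp : p.Splits)
    (hdeg : p.natDegree ≠ 0) : IsProbabilityMeasure (zeroCountingMeasure p) := by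
  have : ∀ s : Multiset ℝ, (s.map fun x => Measure.dirac x).sum Set.univ = Multiset.card s := by
    intro s
    induction s using Multiset.induction with
    | empty => simp
    | cons a s ih => simp [ih, add_comm]
  refine ⟨?_⟩
  rw [zeroCountingMeasure, Measure.smul_apply, this, ← hp.natDegree_eq_card_roots, smul_eq_mul]
  exact ENNReal.inv_mul_cancel (by exact_mod_cast hdeg) (by simp)

theorem integrable_and_integral_sum_dirac (s : Multiset ℝ) (g : ℝ → ℝ) :
    Integrable g (s.map fun x => Measure.dirac x).sum ∧
      ∫ x, g x ∂(s.map fun x => Measure.dirac x).sum = (s.map g).sum := by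
  induction s using Multiset.induction with
  | empty => simp
  | cons a s ih =>
    have ha : Integrable g (Measure.dirac a) := integrable_dirac (by simp)
    simp only [Multiset.map_cons, Multiset.sum_cons]
    exact ⟨ha.add_measure ih.1, by rw [integral_add_measure ha ih.1, ih.2, integral_dirac]⟩

theorem integrable_zeroCountingMeasure {p : ℝ[X]} (hdeg : p.natDegree ≠ 0) (g : ℝ → ℝ) :
    Integrable g (zeroCountingMeasure p) :=
  (integrable_and_integral_sum_dirac _ g).1.smul_measure (by simpa using hdeg)

theorem integral_zeroCountingMeasure (p : ℝ[X]) (g : ℝ → ℝ) :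
    ∫ x, g x ∂(zeroCountingMeasure p) = (p.natDegree : ℝ)⁻¹ * (p.roots.map g).sum := by
  rw [zeroCountingMeasure, integral_smul_measure, (integrable_and_integral_sum_dirac _ g).2]
  simp

/-! ### Generating series of the moments of the zeros -/

/-- The formal power series `∑ x ^ m t ^ m = 1 / (1 - x t)`. -/
def geomSeries (x : ℝ) : PowerSeries ℝ := PowerSeries.mk fun m => x ^ m

/-- The power sums of a multiset, as a generating series `∑_m (∑_{x ∈ s} x ^ m) t ^ m`. -/
def powerSumSeries (s : Multiset ℝ) : PowerSeries ℝ := (s.map geomSeries).sum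

/-- The power series `∏_{x ∈ s} (1 - x t)`. -/
def reversedProd (s : Multiset ℝ) : PowerSeries ℝ :=
  (s.map fun x => 1 - PowerSeries.C x * PowerSeries.X).prod

/-- The Euler operator `θ = t d/dt` on power series. -/
def euler (Y : PowerSeries ℝ) : PowerSeries ℝ := PowerSeries.X * PowerSeries.derivative ℝ Y

theorem coeff_euler (k : ℕ) (Y : PowerSeries ℝ) :
    PowerSeries.coeff k (euler Y) = k * PowerSeries.coeff k Y := by
  cases k with
  | zero => simp [euler]
  | succ k =>
    rw [euler, PowerSeries.coeff_succ_X_mul, PowerSeries.coeff_derivative]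
    push_cast
    ring

theorem euler_mul (Y Z : PowerSeries ℝ) : euler (Y * Z) = euler Y * Z + Y * euler Z := by
  rw [euler, Derivation.leibniz, smul_eq_mul, smul_eq_mul, euler, euler]
  ring

theorem coeff_powerSumSeries (s : Multiset ℝ) (m : ℕ) :
    PowerSeries.coeff m (powerSumSeries s) = (s.map fun x => x ^ m).sum := by
  rw [powerSumSeries, map_multiset_sum, Multiset.map_map]
  simp [Function.comp_def, geomSeries]

theorem constantCoeff_reversedProd (s : Multiset ℝ) :
    PowerSeries.constantCoeff (reversedProd s) = 1 := by
  rw [reversedProd, map_multiset_prod, Multiset.map_map]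
  simp

/-- Logarithmic differentiation of `∏ (1 - x t)`. -/
theorem powerSumSeries_mul_reversedProd (s : Multiset ℝ) :
    powerSumSeries s * reversedProd s
      = (Multiset.card s : PowerSeries ℝ) * reversedProd s - euler (reversedProd s) := by
  induction s using Multiset.induction with
  | empty => simp [powerSumSeries, reversedProd, euler]
  | cons a s ih =>
    have hgeom : geomSeries a * (1 - PowerSeries.C a * PowerSeries.X) = 1 := by
      ext m
      cases m with
      | zero => simp [geomSeries, mul_sub]
      | succ m =>
        rw [mul_sub, mul_one, mul_left_comm, map_sub, PowerSeries.coeff_C_mul,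
          PowerSeries.coeff_succ_mul_X]
        simp [geomSeries, PowerSeries.coeff_one, pow_succ']
    have heuler : euler (1 - PowerSeries.C a * PowerSeries.X)
        = (1 - PowerSeries.C a * PowerSeries.X) - 1 := by
      simp [euler, mul_comm]
    have hS : powerSumSeries (a ::ₘ s) = geomSeries a + powerSumSeries s := by
      simp [powerSumSeries]
    have hQ : reversedProd (a ::ₘ s)
        = (1 - PowerSeries.C a * PowerSeries.X) * reversedProd s := by
      simp [reversedProd]
    rw [hS, hQ, euler_mul, heuler, Multiset.card_cons]
    push_cast
    linear_combination reversedProd s * hgeom + (1 - PowerSeries.C a * PowerSeries.X) * ih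

/-- The coefficients of `∏ (1 - x t)`, over the roots `x` of `p`, are those of `p` in reverse
order. -/
theorem coeff_mul_reversedProd_roots {p : ℝ[X]} (hp : p.Splits) (k : ℕ) :
    p.leadingCoeff * PowerSeries.coeff k (reversedProd p.roots) = p.reverse.coeff k := by
  have h : ∀ s : Multiset ℝ, reversedProd s
      = (((s.map fun x => X - C x).prod.reverse : ℝ[X]) : PowerSeries ℝ) := by
    intro s
    induction s using Multiset.induction with
    | empty =>
      simpa [reversedProd] using
        congrArg (fun q : ℝ[X] => (q : PowerSeries ℝ)) (reverse_C (1 : ℝ)).symm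
    | cons a s ih =>
      have h1 : (X - C a : ℝ[X]).reverse = 1 - C a * X := by
        ext k
        rw [coeff_reverse, natDegree_X_sub_C]
        match k with
        | 0 => simp [revAt_le]
        | 1 => simp [revAt_le, coeff_one]
        | k + 2 =>
          rw [revAt_eq_self_of_lt (by omega)]
          simp [coeff_X, coeff_one]
      rw [Multiset.map_cons, Multiset.prod_cons, reverse_mul_of_domain, h1, Polynomial.coe_mul,
        ← ih]
      simp [reversedProd]
  conv_rhs => rw [hp.eq_prod_roots, reverse_mul_of_domain, reverse_C, coeff_C_mul]
  rw [h, Polynomial.coeff_coe]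

/-- The operator `Y ↦ W Y + a Y - ε θ Y`: conjugation of `1 + a - ε θ` by a power series `Q` with
`W Q = Q - ε θ Q`. -/
def conjEuler (W : PowerSeries ℝ) (ε a : ℝ) (Y : PowerSeries ℝ) : PowerSeries ℝ :=
  W * Y + PowerSeries.C a * Y - PowerSeries.C ε * euler Y

theorem coeff_mul_foldr_conjEuler {W Q : PowerSeries ℝ} {ε : ℝ}
    (hW : W * Q = Q - PowerSeries.C ε * euler Q) (l : List ℝ) (k : ℕ) :
    PowerSeries.coeff k (Q * l.foldr (conjEuler W ε) W) =
      (l.map fun a => 1 + a - ε * k).prod * (1 - ε * k) * PowerSeries.coeff k Q := by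
  induction l with
  | nil =>
    rw [List.foldr_nil, mul_comm, hW, map_sub, PowerSeries.coeff_C_mul, coeff_euler]
    simp
    ring
  | cons a l ih =>
    set Y := l.foldr (conjEuler W ε) W with hY
    have : Q * conjEuler W ε a Y = PowerSeries.C (1 + a) * (Q * Y)
        - PowerSeries.C ε * euler (Q * Y) := by
      rw [conjEuler, euler_mul, map_add, map_one]
      linear_combination Y * hW
    rw [List.foldr_cons, ← hY, this, map_sub, PowerSeries.coeff_C_mul, PowerSeries.coeff_C_mul,
      coeff_euler, ih, List.map_cons, List.prod_cons]
    ring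

/-- The generating series of the moments of the normalized zero counting measure. -/
def momentSeries (r : ℕ) (ν : Fin r → ℕ) (n : ℕ) : PowerSeries ℝ :=
  PowerSeries.C (n : ℝ)⁻¹ * powerSumSeries (scaledF r ν n).roots

theorem coeff_momentSeries (r : ℕ) (ν : Fin r → ℕ) {n : ℕ} (hn : 1 ≤ n) (k : ℕ) :
    PowerSeries.coeff k (momentSeries r ν n) =
      ∫ x, x ^ k ∂(zeroCountingMeasure (scaledF r ν n)) := by
  rw [momentSeries, PowerSeries.coeff_C_mul, coeff_powerSumSeries, integral_zeroCountingMeasure,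
    natDegree_scaledF r ν hn]

/-- The hypergeometric recursion for the coefficients of `F_n(n ^ r x)`, read in reverse order. -/
theorem coeff_succ_reversedProd (r : ℕ) (ν : Fin r → ℕ) {n : ℕ} (hn : 1 ≤ n) (k : ℕ) :
    (n : ℝ)⁻¹ * (k + 1) * PowerSeries.coeff (k + 1) (reversedProd (scaledF r ν n).roots) =
      -((∏ j, (1 + (n : ℝ)⁻¹ * ν j - (n : ℝ)⁻¹ * k)) * (1 - (n : ℝ)⁻¹ * k) *
        PowerSeries.coeff k (reversedProd (scaledF r ν n).roots)) := by
  have hdeg := natDegree_scaledF r ν hn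
  have hlead : (scaledF r ν n).leadingCoeff ≠ 0 := by
    rw [Ne, leadingCoeff_eq_zero]
    intro h
    rw [h, natDegree_zero] at hdeg
    omega
  have hn0 : (n : ℝ) ≠ 0 := by positivity
  refine mul_left_cancel₀ hlead ?_
  have hs := splits_scaledF r ν n
  rw [mul_left_comm, coeff_mul_reversedProd_roots hs, mul_neg, mul_left_comm (leadingCoeff _),
    coeff_mul_reversedProd_roots hs, coeff_reverse, coeff_reverse, hdeg]
  -- For `k = n` the factor `1 - k / n` vanishes; for `k > n` both coefficients do.
  rcases lt_trichotomy k n with hk | rfl | hk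
  · rw [revAt_le hk, revAt_le hk.le]
    obtain ⟨i, rfl⟩ : ∃ i, n = k + 1 + i := ⟨n - (k + 1), by omega⟩
    rw [show k + 1 + i - (k + 1) = i by omega, show k + 1 + i - k = i + 1 by omega,
      coeff_scaledF, coeff_scaledF]
    have hchoose : ((k + 1 + i).choose (i + 1) : ℝ) * (i + 1)
        = ((k + 1 + i).choose i : ℝ) * (k + 1) := by
      have := Nat.choose_succ_right_eq (k + 1 + i) i
      rw [show k + 1 + i - i = k + 1 by omega] at this
      exact_mod_cast this
    have hprod : (∏ j, (1 + ((k + 1 + i : ℕ) : ℝ)⁻¹ * ν j - ((k + 1 + i : ℕ) : ℝ)⁻¹ * k))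
        = (∏ j, ((i + 1 + ν j).factorial : ℝ)) / (∏ j, ((i + ν j).factorial : ℝ))
          / ((k + 1 + i : ℕ) : ℝ) ^ r := by
      rw [← Finset.prod_div_distrib, show ((k + 1 + i : ℕ) : ℝ) ^ r
        = ∏ _j : Fin r, ((k + 1 + i : ℕ) : ℝ) by simp, ← Finset.prod_div_distrib]
      refine Finset.prod_congr rfl fun j _ => ?_
      have : ((i + ν j).factorial : ℝ) ≠ 0 := by exact_mod_cast Nat.factorial_ne_zero _
      rw [show i + 1 + ν j = i + ν j + 1 by ring, Nat.factorial_succ]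
      push_cast at hn0 ⊢
      field_simp
      ring
    have h1 : ∏ j, ((i + 1 + ν j).factorial : ℝ) ≠ 0 :=
      Finset.prod_ne_zero_iff.2 fun j _ => by exact_mod_cast Nat.factorial_ne_zero _
    have h2 : ∏ j, ((i + ν j).factorial : ℝ) ≠ 0 :=
      Finset.prod_ne_zero_iff.2 fun j _ => by exact_mod_cast Nat.factorial_ne_zero _
    have h3 : 1 - ((k + 1 + i : ℕ) : ℝ)⁻¹ * k = (i + 1) / ((k + 1 + i : ℕ) : ℝ) := by
      field_simp
      push_cast
      ring
    rw [hprod, h3]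
    generalize ∏ j, ((i + 1 + ν j).factorial : ℝ) = A at *
    generalize ∏ j, ((i + ν j).factorial : ℝ) = B at *
    generalize ((k + 1 + i : ℕ) : ℝ) = N at *
    rw [pow_succ (N ^ r), pow_succ (-1 : ℝ)]
    have hNr : N ^ r ≠ 0 := pow_ne_zero _ hn0
    generalize N ^ r = M at *
    field_simp
    linear_combination (-1 : ℝ) * hchoose
  · rw [inv_mul_cancel₀ hn0, revAt_eq_self_of_lt (Nat.lt_succ_self k),
      coeff_eq_zero_of_natDegree_lt (by omega)]
    simp
  · rw [revAt_eq_self_of_lt hk, revAt_eq_self_of_lt (by omega),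
      coeff_eq_zero_of_natDegree_lt (by omega), coeff_eq_zero_of_natDegree_lt (by omega)]
    simp

/-- The Riccati-type form of the hypergeometric equation, a perturbation of
`W = 1 + t W ^ (r + 1)`. -/
theorem momentSeries_eq (r : ℕ) (ν : Fin r → ℕ) {n : ℕ} (hn : 1 ≤ n) :
    momentSeries r ν n = 1 + PowerSeries.X *
      (List.ofFn fun j => (n : ℝ)⁻¹ * ν j).foldr (conjEuler (momentSeries r ν n) (n : ℝ)⁻¹)
        (momentSeries r ν n) := by
  set Q := reversedProd (scaledF r ν n).roots with hQdef
  have hn0 : (n : ℝ) ≠ 0 := by positivity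
  have hQ0 : Q ≠ 0 := by
    intro h
    have := constantCoeff_reversedProd (scaledF r ν n).roots
    rw [← hQdef, h] at this
    simp at this
  have hW : momentSeries r ν n * Q = Q - PowerSeries.C (n : ℝ)⁻¹ * euler Q := by
    rw [momentSeries, mul_assoc, powerSumSeries_mul_reversedProd, card_roots_scaledF r ν hn,
      mul_sub, ← mul_assoc]
    congr 1
    rw [show ((n : PowerSeries ℝ)) = PowerSeries.C (n : ℝ) by simp, ← map_mul,
      inv_mul_cancel₀ hn0, map_one, one_mul]
  refine mul_left_cancel₀ hQ0 ?_
  rw [mul_comm, hW, mul_add, mul_one, mul_left_comm, sub_eq_add_neg]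
  congr 1
  ext k
  rw [map_neg, PowerSeries.coeff_C_mul, coeff_euler]
  cases k with
  | zero => simp
  | succ k =>
    rw [PowerSeries.coeff_succ_X_mul, coeff_mul_foldr_conjEuler hW, List.map_ofFn, List.prod_ofFn]
    have := coeff_succ_reversedProd r ν hn k
    rw [← hQdef] at this
    simp only [Function.comp_apply]
    push_cast
    linear_combination (-1 : ℝ) * this

/-! ### The Fuss–Catalan series -/

/-- The coefficients of the formal solution of `W = 1 + t W ^ (r + 1)`, computed recursively. -/
def fussCatalanCoeff (r : ℕ) : ℕ → ℝ
  | 0 => 1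
  | m + 1 => PowerSeries.coeff m
      ((PowerSeries.mk fun i => if _h : i < m + 1 then fussCatalanCoeff r i else 0) ^ (r + 1))

/-- The formal solution of `W = 1 + t W ^ (r + 1)`. -/
def fussCatalanSeries (r : ℕ) : PowerSeries ℝ := PowerSeries.mk (fussCatalanCoeff r)

theorem fussCatalanSeries_eq (r : ℕ) :
    fussCatalanSeries r = 1 + PowerSeries.X * fussCatalanSeries r ^ (r + 1) := by
  ext m
  cases m with
  | zero => simp [fussCatalanSeries, fussCatalanCoeff]
  | succ m =>
    rw [map_add, PowerSeries.coeff_succ_X_mul, PowerSeries.coeff_one, if_neg m.succ_ne_zero,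
      zero_add]
    conv_lhs => rw [fussCatalanSeries, PowerSeries.coeff_mk, fussCatalanCoeff]
    set Y : PowerSeries ℝ :=
      PowerSeries.mk fun i => if _h : i < m + 1 then fussCatalanCoeff r i else 0 with hY
    have h1 : (PowerSeries.X : PowerSeries ℝ) ^ (m + 1) ∣ Y - fussCatalanSeries r := by
      refine PowerSeries.X_pow_dvd_iff.2 fun i hi => ?_
      simp [hY, fussCatalanSeries, Nat.lt_succ_iff.1 hi]
    have h2 := PowerSeries.X_pow_dvd_iff.1 (h1.trans (sub_dvd_pow_sub_pow _ _ (r + 1))) m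
      (Nat.lt_succ_self m)
    rwa [map_sub, sub_eq_zero] at h2

/-- The coefficients of the powers of `W` satisfy `c_k(a + 1) = c_k(a) + c_{k-1}(a + r + 1)`, as do
the numbers `a / (a + (r + 1) k) * binom(a + (r + 1) k, k)`. -/
theorem coeff_fussCatalanSeries_pow (r k a : ℕ) :
    PowerSeries.coeff k (fussCatalanSeries r ^ (a + 1)) =
      ((a : ℝ) + 1) / (a + 1 + (r + 1) * k) * ((a + 1 + (r + 1) * k).choose k : ℝ) := by
  have hstep : ∀ a : ℕ, fussCatalanSeries r ^ (a + 1) =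
      fussCatalanSeries r ^ a + PowerSeries.X * fussCatalanSeries r ^ (a + r + 1) := by
    intro a
    conv_lhs => rw [pow_succ, fussCatalanSeries_eq r, mul_add, mul_one]
    rw [← fussCatalanSeries_eq r]
    ring
  induction k generalizing a with
  | zero =>
    have : PowerSeries.constantCoeff (fussCatalanSeries r) = 1 := by
      rw [fussCatalanSeries_eq]; simp
    have h1 : (a : ℝ) + 1 ≠ 0 := by positivity
    simp [this, div_self h1]
  | succ k ihk =>
    -- Pascal's rule in the form of the recursion in `a`, for the closed expressions.
    have hid : ∀ a : ℕ, (a : ℝ) / (a + (r + 1) * (k + 1)) *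
          ((a + (r + 1) * (k + 1)).choose (k + 1) : ℝ) +
        ((a : ℝ) + r + 1) / (a + (r + 1) * (k + 1)) * ((a + (r + 1) * (k + 1)).choose k : ℝ) =
        ((a : ℝ) + 1) / (a + 1 + (r + 1) * (k + 1)) *
          ((a + 1 + (r + 1) * (k + 1)).choose (k + 1) : ℝ) := by
      intro a
      have hM : ((a : ℝ) + (r + 1) * (k + 1)) ≠ 0 := by positivity
      have hM1 : ((a : ℝ) + 1 + (r + 1) * (k + 1)) ≠ 0 := by positivity
      obtain ⟨M, hMdef⟩ : ∃ M, M = a + (r + 1) * (k + 1) := ⟨_, rfl⟩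
      have hMk : k ≤ M := by rw [hMdef]; nlinarith
      have h1 : (M.choose (k + 1) : ℝ) * (k + 1) = M.choose k * (M - k) := by
        rw [← Nat.cast_sub hMk]
        exact_mod_cast Nat.choose_succ_right_eq M k
      have h2 : ((M + 1).choose (k + 1) : ℝ) = M.choose k + M.choose (k + 1) := by
        exact_mod_cast Nat.choose_succ_succ M k
      rw [show a + 1 + (r + 1) * (k + 1) = M + 1 by omega, ← hMdef, h2]
      have hMr : (M : ℝ) = a + (r + 1) * (k + 1) := by rw [hMdef]; push_cast; ring
      have hk : ((k : ℝ) + 1) ≠ 0 := by positivity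
      rw [eq_div_of_mul_eq hk h1, hMr]
      field_simp
      ring
    induction a with
    | zero =>
      have := hid 0
      have hk := ihk r
      rw [hstep, map_add, PowerSeries.coeff_succ_X_mul, pow_zero, PowerSeries.coeff_one,
        if_neg k.succ_ne_zero, zero_add r, hk, show r + 1 + (r + 1) * k = 0 + (r + 1) * (k + 1) by
          ring]
      push_cast at this ⊢
      rw [← this]
      ring
    | succ a iha =>
      have := hid (a + 1)
      have hk := ihk (a + 1 + r)
      rw [hstep, map_add, PowerSeries.coeff_succ_X_mul, iha, hk,
        show a + 1 + r + 1 + (r + 1) * k = a + 1 + (r + 1) * (k + 1) by ring]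
      push_cast at this ⊢
      rw [← this]
      ring

theorem coeff_fussCatalanSeries (r k : ℕ) :
    PowerSeries.coeff k (fussCatalanSeries r) =
      ((r * k + k).choose k : ℝ) / ((r : ℝ) * k + 1) := by
  have h := coeff_fussCatalanSeries_pow r k 0
  rw [zero_add, pow_one] at h
  rw [h, show 0 + 1 + (r + 1) * k = r * k + k + 1 by ring]
  have h1 := Nat.choose_mul_succ_eq (r * k + k) k
  rw [show r * k + k + 1 - k = r * k + 1 by omega] at h1
  have h2 : ((r * k + k).choose k : ℝ) * (r * k + k + 1)
      = ((r * k + k + 1).choose k : ℝ) * (r * k + 1) := by exact_mod_cast h1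
  have : ((r : ℝ) * k + 1) ≠ 0 := by positivity
  have : ((1 : ℝ) + (r + 1) * k) ≠ 0 := by positivity
  push_cast
  field_simp
  linear_combination -h2

/-! ### Convergence of the moments of the zeros -/

theorem tendsto_coeff_conjEuler {W Y : ℕ → PowerSeries ℝ} {W₀ Y₀ : PowerSeries ℝ} {ε a : ℕ → ℝ}
    (hε : Tendsto ε atTop (𝓝 0)) (ha : Tendsto a atTop (𝓝 0)) {m : ℕ}
    (hW : ∀ j ≤ m, Tendsto (fun n => PowerSeries.coeff j (W n)) atTop
      (𝓝 (PowerSeries.coeff j W₀)))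
    (hY : ∀ j ≤ m, Tendsto (fun n => PowerSeries.coeff j (Y n)) atTop
      (𝓝 (PowerSeries.coeff j Y₀))) :
    ∀ j ≤ m, Tendsto (fun n => PowerSeries.coeff j (conjEuler (W n) (ε n) (a n) (Y n))) atTop
      (𝓝 (PowerSeries.coeff j (W₀ * Y₀))) := by
  intro j hj
  simp only [conjEuler, map_add, map_sub, PowerSeries.coeff_C_mul, coeff_euler]
  have h1 : Tendsto (fun n => PowerSeries.coeff j (W n * Y n)) atTop
      (𝓝 (PowerSeries.coeff j (W₀ * Y₀))) := by
    simp only [PowerSeries.coeff_mul]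
    refine tendsto_finsetSum _ fun p hp => ?_
    have := Finset.HasAntidiagonal.mem_antidiagonal.1 hp
    exact (hW _ (by omega)).mul (hY _ (by omega))
  simpa using (h1.add (ha.mul (hY j hj))).sub (hε.mul ((hY j hj).const_mul (j : ℝ)))

theorem tendsto_coeff_foldr_conjEuler {W : ℕ → PowerSeries ℝ} {W₀ : PowerSeries ℝ} {m : ℕ}
    (hW : ∀ j ≤ m, Tendsto (fun n => PowerSeries.coeff j (W n)) atTop
      (𝓝 (PowerSeries.coeff j W₀))) (l : List ℕ) :
    ∀ j ≤ m, Tendsto (fun n : ℕ => PowerSeries.coeff j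
      ((l.map fun v : ℕ => (n : ℝ)⁻¹ * (v : ℝ)).foldr (conjEuler (W n) (n : ℝ)⁻¹) (W n))) atTop
      (𝓝 (PowerSeries.coeff j (W₀ ^ (l.length + 1)))) := by
  have hinv : Tendsto (fun n : ℕ => (n : ℝ)⁻¹) atTop (𝓝 0) := tendsto_inv_atTop_nhds_zero_nat
  induction l with
  | nil => simpa using hW
  | cons v l ih =>
    rw [List.length_cons, pow_succ']
    simp only [List.map_cons, List.foldr_cons]
    exact tendsto_coeff_conjEuler hinv (by simpa using hinv.mul_const (v : ℝ)) hW ih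

theorem tendsto_coeff_momentSeries (r : ℕ) (ν : Fin r → ℕ) (m : ℕ) :
    Tendsto (fun n => PowerSeries.coeff m (momentSeries r ν n)) atTop
      (𝓝 (PowerSeries.coeff m (fussCatalanSeries r))) := by
  induction m using Nat.strong_induction_on with
  | _ m ih =>
    have hev : ∀ᶠ n : ℕ in atTop, 1 ≤ n := eventually_ge_atTop 1
    cases m with
    | zero =>
      rw [fussCatalanSeries_eq]
      refine tendsto_const_nhds.congr' (hev.mono fun n hn => ?_)
      beta_reduce
      rw [momentSeries_eq r ν hn]
      simp
    | succ m =>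
      have h := tendsto_coeff_foldr_conjEuler (fun j hj => ih j (Nat.lt_succ_of_le hj))
        (List.ofFn ν) m le_rfl
      rw [fussCatalanSeries_eq, map_add, PowerSeries.coeff_succ_X_mul, PowerSeries.coeff_one,
        if_neg m.succ_ne_zero, zero_add]
      rw [List.length_ofFn] at h
      refine h.congr' (hev.mono fun n hn => ?_)
      beta_reduce
      conv_rhs => rw [momentSeries_eq r ν hn]
      rw [map_add, PowerSeries.coeff_succ_X_mul, PowerSeries.coeff_one, if_neg m.succ_ne_zero,
        zero_add, List.map_ofFn]
      rfl

/-- The moments of the zero counting measures converge to the Fuss–Catalan numbers. -/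
theorem tendsto_moments_zeroCountingMeasure (r : ℕ) (ν : Fin r → ℕ) (k : ℕ) :
    Tendsto (fun n => ∫ x, x ^ k ∂(zeroCountingMeasure (scaledF r ν n))) atTop
      (𝓝 (((r * k + k).choose k : ℝ) / ((r : ℝ) * k + 1))) := by
  rw [← coeff_fussCatalanSeries]
  exact (tendsto_coeff_momentSeries r ν k).congr'
    ((eventually_ge_atTop 1).mono fun n hn => coeff_momentSeries r ν hn k)

/-! ### The method of moments -/

/-- The exponential `e^{cx}` stays within `x ^ n / n!` of its Taylor polynomial for `x ≥ 0`, when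
`|c| = 1` and `e^{cx}` is bounded by one; unlike the bounds for the full exponential series, there
is no factor growing with `x`. -/
theorem norm_exp_sub_taylor_le {c : ℂ} (hc : ‖c‖ = 1)
    (hexp : ∀ x : ℝ, 0 ≤ x → ‖Complex.exp (c * x)‖ ≤ 1) (n : ℕ) {x : ℝ} (hx : 0 ≤ x) :
    ‖Complex.exp (c * x) - ∑ k ∈ Finset.range n, (c * x) ^ k / (k.factorial : ℂ)‖
      ≤ x ^ n / n.factorial := by
  induction n generalizing x with
  | zero => simpa using hexp x hx
  | succ n ih =>
    have hd : ∀ y : ℝ, HasDerivAt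
        (fun y : ℝ => Complex.exp (c * y) -
          ∑ k ∈ Finset.range (n + 1), (c * y) ^ k / (k.factorial : ℂ))
        (c * (Complex.exp (c * y) - ∑ k ∈ Finset.range n, (c * y) ^ k / (k.factorial : ℂ))) y := by
      intro y
      have h1 : HasDerivAt (fun y : ℝ => c * (y : ℂ)) c y := by
        simpa using (Complex.ofRealCLM.hasDerivAt (x := y)).const_mul c
      have h2 : HasDerivAt (fun y : ℝ => ∑ k ∈ Finset.range n,
          (c * (y : ℂ)) ^ (k + 1) / ((k + 1).factorial : ℂ))
          (∑ k ∈ Finset.range n, c * ((c * y) ^ k / (k.factorial : ℂ))) y := by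
        refine HasDerivAt.fun_sum fun k _ => ?_
        refine ((h1.pow (k + 1)).div_const ((k + 1).factorial : ℂ)).congr_deriv ?_
        have : (k.factorial : ℂ) ≠ 0 := by exact_mod_cast k.factorial_ne_zero
        have : ((k : ℂ) + 1) ≠ 0 := by exact_mod_cast k.succ_ne_zero
        rw [Nat.factorial_succ]
        push_cast
        field_simp
      have h3 := h1.cexp.sub (h2.add_const 1)
      rw [show (fun y : ℝ => Complex.exp (c * y) -
          ∑ k ∈ Finset.range (n + 1), (c * y) ^ k / (k.factorial : ℂ)) = _ - _ from funext
            fun z => by simp [Finset.sum_range_succ']; rfl]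
      refine h3.congr_deriv ?_
      rw [← Finset.mul_sum]
      ring
    have hB : ∀ y : ℝ, HasDerivAt (fun y : ℝ => y ^ (n + 1) / ((n + 1).factorial : ℝ))
        (y ^ n / n.factorial) y := by
      intro y
      refine ((hasDerivAt_pow (n + 1) y).div_const ((n + 1).factorial : ℝ)).congr_deriv ?_
      have : (n.factorial : ℝ) ≠ 0 := by exact_mod_cast n.factorial_ne_zero
      rw [Nat.factorial_succ]
      push_cast
      field_simp
    refine image_norm_le_of_norm_deriv_right_le_deriv_boundary (a := 0) (b := x)
      (fun y _ => (hd y).continuousAt.continuousWithinAt)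
      (fun y _ => (hd y).hasDerivWithinAt) ?_ hB ?_ ⟨hx, le_rfl⟩
    · simp [Finset.sum_range_succ']
    · intro y hy
      rw [norm_mul, hc, one_mul]
      exact ih hy.1

theorem norm_exp_mul_I_sub_taylor_le (n : ℕ) (x : ℝ) :
    ‖Complex.exp (x * Complex.I) -
      ∑ k ∈ Finset.range n, (x * Complex.I) ^ k / (k.factorial : ℂ)‖ ≤ |x| ^ n / n.factorial := by
  rcases le_total 0 x with hx | hx
  · have := norm_exp_sub_taylor_le (c := Complex.I) (by simp)
      (fun y _ => by rw [mul_comm, Complex.norm_exp_ofReal_mul_I]) n hx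
    rw [abs_of_nonneg hx]
    simpa only [mul_comm Complex.I] using this
  · have := norm_exp_sub_taylor_le (c := -Complex.I) (by simp)
      (fun y _ => by
        rw [show -Complex.I * (y : ℂ) = ((-y : ℝ) : ℂ) * Complex.I by push_cast; ring,
          Complex.norm_exp_ofReal_mul_I]) n (neg_nonneg.2 hx)
    rw [abs_of_nonpos hx]
    simpa [mul_comm] using this

/-- The characteristic function is approximated by moments, up to the next even moment. -/
theorem norm_charFun_sub_moments_le (m : ProbabilityMeasure ℝ)
    (hm : ∀ k : ℕ, Integrable (fun x : ℝ => x ^ k) (m : Measure ℝ)) (t : ℝ) (L : ℕ) :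
    ‖charFun (m : Measure ℝ) t - ∑ k ∈ Finset.range (2 * L),
      (t * Complex.I) ^ k / (k.factorial : ℂ) * ((∫ x, x ^ k ∂(m : Measure ℝ) : ℝ) : ℂ)‖
      ≤ t ^ (2 * L) / (2 * L).factorial * ∫ x, x ^ (2 * L) ∂(m : Measure ℝ) := by
  have hint : ∀ k : ℕ, Integrable (fun x : ℝ => (t * Complex.I) ^ k / (k.factorial : ℂ) *
      ((x ^ k : ℝ) : ℂ)) (m : Measure ℝ) := fun k => (hm k).ofReal.const_mul _
  have hsum : ∑ k ∈ Finset.range (2 * L), (t * Complex.I) ^ k / (k.factorial : ℂ) *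
      ((∫ x, x ^ k ∂(m : Measure ℝ) : ℝ) : ℂ) = ∫ x : ℝ, ∑ k ∈ Finset.range (2 * L),
        (t * Complex.I) ^ k / (k.factorial : ℂ) * ((x ^ k : ℝ) : ℂ) ∂(m : Measure ℝ) := by
    rw [integral_finsetSum _ fun k _ => hint k]
    refine Finset.sum_congr rfl fun k _ => ?_
    rw [integral_const_mul, integral_complex_ofReal]
  have hexp : Integrable (fun x : ℝ => Complex.exp (t * x * Complex.I)) (m : Measure ℝ) := by
    refine Integrable.of_bound (C := 1) (by fun_prop) (ae_of_all _ fun x => ?_)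
    rw [← Complex.ofReal_mul, Complex.norm_exp_ofReal_mul_I]
  rw [hsum, charFun_apply_real, ← integral_sub hexp (integrable_finsetSum _ fun k _ => hint k),
    ← integral_const_mul]
  refine norm_integral_le_of_norm_le ((hm (2 * L)).const_mul _) (ae_of_all _ fun x => ?_)
  have := norm_exp_mul_I_sub_taylor_le (2 * L) (t * x)
  rw [abs_mul, mul_pow, pow_mul |t|, sq_abs, ← pow_mul, pow_mul |x|, sq_abs, ← pow_mul] at this
  push_cast at this
  convert this using 1
  · congr 2
    refine Finset.sum_congr rfl fun k _ => ?_
    push_cast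
    ring
  · ring

/-- **Method of moments.** If the moments converge to those of a compactly supported probability
measure, then the measures converge weakly. -/
theorem tendsto_of_tendsto_moments {μn : ℕ → ProbabilityMeasure ℝ} {μ : ProbabilityMeasure ℝ}
    {R : ℝ}
    (hn : ∀ n k : ℕ, Integrable (fun x : ℝ => x ^ k) (μn n : Measure ℝ))
    (hμ : ∀ k : ℕ, Integrable (fun x : ℝ => x ^ k) (μ : Measure ℝ))
    (hbound : ∀ k : ℕ, ∫ x, x ^ k ∂(μ : Measure ℝ) ≤ R ^ k)
    (hlim : ∀ k : ℕ, Tendsto (fun n => ∫ x, x ^ k ∂(μn n : Measure ℝ)) atTop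
      (𝓝 (∫ x, x ^ k ∂(μ : Measure ℝ)))) :
    Tendsto μn atTop (𝓝 μ) := by
  refine ProbabilityMeasure.tendsto_iff_tendsto_charFun.2 fun t => ?_
  rw [Metric.tendsto_atTop']
  intro ε hε
  obtain ⟨L, hL⟩ : ∃ L : ℕ, (t ^ 2 * R ^ 2) ^ L / (2 * L).factorial < ε / 4 := by
    have h := (FloorSemiring.tendsto_pow_div_factorial_atTop (|t| * R)).comp
      (tendsto_id.const_mul_atTop' (show 0 < 2 by norm_num) : Tendsto (fun L : ℕ => 2 * L) _ _)
    obtain ⟨L, hL⟩ := (h.eventually_lt_const (show (0 : ℝ) < ε / 4 by positivity)).exists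
    refine ⟨L, ?_⟩
    simpa [pow_mul, mul_pow] using hL
  have hA : t ^ (2 * L) / (2 * L).factorial * ∫ x, x ^ (2 * L) ∂(μ : Measure ℝ) < ε / 4 := by
    refine lt_of_le_of_lt ?_ hL
    rw [mul_pow, ← pow_mul, ← pow_mul, mul_div_right_comm]
    have : 0 ≤ t ^ (2 * L) := by rw [pow_mul]; positivity
    exact mul_le_mul_of_nonneg_left (hbound _) (by positivity)
  have h1 : ∀ᶠ n in atTop, t ^ (2 * L) / (2 * L).factorial *
      ∫ x, x ^ (2 * L) ∂(μn n : Measure ℝ) < ε / 4 :=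
    ((hlim (2 * L)).const_mul _).eventually_lt_const hA
  have h2 : Tendsto (fun n => ∑ k ∈ Finset.range (2 * L),
      (t * Complex.I) ^ k / (k.factorial : ℂ) * ((∫ x, x ^ k ∂(μn n : Measure ℝ) : ℝ) : ℂ)) atTop
      (𝓝 (∑ k ∈ Finset.range (2 * L), (t * Complex.I) ^ k / (k.factorial : ℂ) *
        ((∫ x, x ^ k ∂(μ : Measure ℝ) : ℝ) : ℂ))) :=
    tendsto_finsetSum _ fun k _ =>
      ((Complex.continuous_ofReal.tendsto _).comp (hlim k)).const_mul _
  have h3 := (Metric.tendsto_nhds.1 h2) (ε / 4) (by positivity)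
  obtain ⟨N, hN⟩ := eventually_atTop.1 (h1.and h3)
  refine ⟨N, fun n hnN => ?_⟩
  obtain ⟨hn1, hn3⟩ := hN n hnN.le
  have ha := norm_charFun_sub_moments_le (μn n) (hn n) t L
  have hb := norm_charFun_sub_moments_le μ hμ t L
  rw [← dist_eq_norm] at ha hb
  rw [dist_comm] at hb
  have := dist_triangle4 (charFun (μn n : Measure ℝ) t) _ _ (charFun (μ : Measure ℝ) t)
    |>.trans (add_le_add (add_le_add ha hn3.le) hb)
  linarith

/-! ### The bijection `ρ` and the curve `u` -/

theorem pi_div_pos (r : ℕ) : 0 < Real.pi / ((r : ℝ) + 1) := by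
  have := Real.pi_pos
  positivity

theorem sin_pos_of_mem {r : ℕ} (hr : 1 ≤ r) {φ : ℝ}
    (hφ : φ ∈ Set.Ioc 0 (Real.pi / ((r : ℝ) + 1))) :
    0 < Real.sin φ ∧ 0 < Real.sin (r * φ) := by
  have hr' : (1 : ℝ) ≤ r := by exact_mod_cast hr
  have h1 : φ * (r + 1) ≤ Real.pi := (le_div_iff₀ (by positivity)).1 hφ.2
  have h0 := hφ.1
  exact ⟨Real.sin_pos_of_pos_of_lt_pi h0 (by nlinarith),
    Real.sin_pos_of_pos_of_lt_pi (by positivity) (by nlinarith)⟩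

theorem sin_succ_mul_pos_of_mem {r : ℕ} {φ : ℝ} (hφ : φ ∈ paramInterval r) :
    0 < Real.sin (((r : ℝ) + 1) * φ) := by
  have h1 : φ * (r + 1) < Real.pi := (lt_div_iff₀ (by positivity)).1 hφ.2
  have h0 := hφ.1
  exact Real.sin_pos_of_pos_of_lt_pi (by positivity) (by linarith)

/-- The quotient `sin φ / sin (r φ)`, written as the reciprocal of a Chebyshev polynomial in
`cos φ` so that it takes the right value `1 / r` at `φ = 0`. -/
def sinQuot (r : ℕ) (φ : ℝ) : ℝ := ((Chebyshev.U ℝ ((r : ℤ) - 1)).eval (Real.cos φ))⁻¹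

theorem sinQuot_eq {r : ℕ} (hr : 1 ≤ r) {φ : ℝ}
    (hφ : φ ∈ Set.Ioc 0 (Real.pi / ((r : ℝ) + 1))) :
    sinQuot r φ = Real.sin φ / Real.sin (r * φ) := by
  have h := Chebyshev.U_real_cos φ ((r : ℤ) - 1)
  obtain ⟨h1, h2⟩ := sin_pos_of_mem hr hφ
  push_cast at h
  rw [sub_add_cancel] at h
  rw [sinQuot, ← h]
  field_simp

theorem sinQuot_zero (r : ℕ) : sinQuot r 0 = (r : ℝ)⁻¹ := by
  simp [sinQuot]

theorem sinQuot_pos {r : ℕ} (hr : 1 ≤ r) {φ : ℝ}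
    (hφ : φ ∈ Set.Icc 0 (Real.pi / ((r : ℝ) + 1))) : 0 < sinQuot r φ := by
  rcases hφ.1.eq_or_lt with rfl | h0
  · rw [sinQuot_zero]
    positivity
  · obtain ⟨h1, h2⟩ := sin_pos_of_mem hr ⟨h0, hφ.2⟩
    rw [sinQuot_eq hr ⟨h0, hφ.2⟩]
    positivity

theorem continuousOn_sinQuot {r : ℕ} (hr : 1 ≤ r) :
    ContinuousOn (sinQuot r) (Set.Icc 0 (Real.pi / ((r : ℝ) + 1))) := by
  refine ContinuousOn.inv₀ (by fun_prop) fun φ hφ => ?_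
  exact fun h => (sinQuot_pos hr hφ).ne' (by rw [sinQuot, h, inv_zero])

@[fun_prop]
theorem measurable_sinQuot (r : ℕ) : Measurable (sinQuot r) := by
  unfold sinQuot
  fun_prop

theorem mul_pi_div_eq (r : ℕ) : (r : ℝ) * (Real.pi / (r + 1)) = Real.pi - Real.pi / (r + 1) := by
  have : (r : ℝ) + 1 ≠ 0 := by positivity
  field_simp
  ring

theorem sinQuot_right {r : ℕ} (hr : 1 ≤ r) : sinQuot r (Real.pi / ((r : ℝ) + 1)) = 1 := by
  have h := pi_div_pos r
  rw [sinQuot_eq hr ⟨h, le_rfl⟩, mul_pi_div_eq, Real.sin_pi_sub]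
  exact div_self (sin_pos_of_mem hr ⟨h, le_rfl⟩).1.ne'

/-- The continuous extension of `ρ` to the closed parameter interval. -/
def rhoExt (r : ℕ) (φ : ℝ) : ℝ :=
  (Real.cos φ + sinQuot r φ * Real.cos (r * φ)) ^ (r + 1) / sinQuot r φ

/-- On the open interval, `cos φ + (sin φ / sin (r φ)) cos (r φ) = sin ((r + 1) φ) / sin (r φ)`. -/
theorem rhoExt_eq {r : ℕ} (hr : 1 ≤ r) {φ : ℝ} (hφ : φ ∈ paramInterval r) :
    rhoExt r φ = rho r φ := by
  obtain ⟨h1, h2⟩ := sin_pos_of_mem hr ⟨hφ.1, hφ.2.le⟩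
  have h3 : Real.cos φ + Real.sin φ / Real.sin (r * φ) * Real.cos (r * φ)
      = Real.sin (((r : ℝ) + 1) * φ) / Real.sin (r * φ) := by
    rw [add_one_mul, Real.sin_add]
    field_simp
  rw [rhoExt, sinQuot_eq hr ⟨hφ.1, hφ.2.le⟩, h3, rho, div_pow, pow_succ (Real.sin (r * φ))]
  field_simp

theorem rhoExt_zero {r : ℕ} (hr : 1 ≤ r) : rhoExt r 0 = xStar r := by
  have : (r : ℝ) ≠ 0 := by positivity
  have h : (1 : ℝ) + (r : ℝ)⁻¹ = (r + 1) / r := by field_simp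
  rw [rhoExt, sinQuot_zero, xStar]
  simp only [mul_zero, Real.cos_zero, mul_one]
  rw [h, div_pow, pow_succ (r : ℝ)]
  field_simp

theorem rhoExt_right {r : ℕ} (hr : 1 ≤ r) : rhoExt r (Real.pi / ((r : ℝ) + 1)) = 0 := by
  rw [rhoExt, sinQuot_right hr, mul_pi_div_eq, Real.cos_pi_sub]
  simp

theorem continuousOn_rhoExt {r : ℕ} (hr : 1 ≤ r) :
    ContinuousOn (rhoExt r) (Set.Icc 0 (Real.pi / ((r : ℝ) + 1))) := by
  have := continuousOn_sinQuot hr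
  unfold rhoExt
  exact ContinuousOn.div (by fun_prop) this fun φ hφ => (sinQuot_pos hr hφ).ne'

theorem hasDerivAt_sin_mul (a φ : ℝ) :
    HasDerivAt (fun φ => Real.sin (a * φ)) (Real.cos (a * φ) * a) φ := by
  have h : HasDerivAt (fun φ : ℝ => a * φ) a φ := by simpa using (hasDerivAt_id φ).const_mul a
  exact h.sin

/-- With `A = cot φ` and `B = cot (r φ)`, the logarithmic derivative of `ρ` is
`-((A - r B) ^ 2 + (r + 1) ^ 2) / (A + B)`, hence negative. -/
theorem deriv_rhoExt_neg {r : ℕ} (hr : 1 ≤ r) {φ : ℝ} (hφ : φ ∈ paramInterval r) :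
    deriv (rhoExt r) φ < 0 := by
  obtain ⟨h1, h2⟩ := sin_pos_of_mem hr ⟨hφ.1, hφ.2.le⟩
  have h3 := sin_succ_mul_pos_of_mem hφ
  -- The factor `1 *` gives all three sines the form of `hasDerivAt_sin_mul`.
  have heq : rhoExt r =ᶠ[𝓝 φ] fun φ => Real.exp ((r + 1) * Real.log (Real.sin (((r : ℝ) + 1) * φ))
      - Real.log (Real.sin (1 * φ)) - r * Real.log (Real.sin (r * φ))) := by
    filter_upwards [isOpen_Ioo.mem_nhds hφ] with θ hθ
    obtain ⟨h1, h2⟩ := sin_pos_of_mem hr ⟨hθ.1, hθ.2.le⟩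
    have h3 := sin_succ_mul_pos_of_mem hθ
    rw [rhoExt_eq hr hθ, rho, Real.exp_sub, Real.exp_sub, one_mul, Real.exp_log h1,
      Real.exp_nat_mul, Real.exp_log h2]
    have : ((r : ℝ) + 1) = ((r + 1 : ℕ) : ℝ) := by push_cast; ring
    conv_rhs => rw [this, Real.exp_nat_mul, ← this, Real.exp_log h3]
    rw [div_div]
  have hd := ((((hasDerivAt_sin_mul ((r : ℝ) + 1) φ).log h3.ne').const_mul ((r : ℝ) + 1)).sub
    ((hasDerivAt_sin_mul 1 φ).log (by simpa using h1.ne'))).sub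
    (((hasDerivAt_sin_mul r φ).log h2.ne').const_mul (r : ℝ)) |>.exp
  rw [heq.deriv_eq]
  refine lt_of_eq_of_lt hd.deriv (mul_neg_of_pos_of_neg (Real.exp_pos _) ?_)
  simp only [one_mul, mul_one]
  set A := Real.cos φ / Real.sin φ with hA
  set B := Real.cos (r * φ) / Real.sin (r * φ) with hB
  have hsin : Real.sin (((r : ℝ) + 1) * φ) = Real.sin φ * Real.sin (r * φ) * (A + B) := by
    rw [add_one_mul, Real.sin_add, hA, hB]
    field_simp
  have hcos : Real.cos (((r : ℝ) + 1) * φ) = Real.sin φ * Real.sin (r * φ) * (A * B - 1) := by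
    rw [add_one_mul, Real.cos_add, hA, hB]
    field_simp
  have hAB : 0 < A + B := by
    rw [hsin] at h3
    exact pos_of_mul_pos_right h3 (by positivity)
  have hkey : ((r : ℝ) + 1) * (Real.cos (((r : ℝ) + 1) * φ) * (r + 1) /
      Real.sin (((r : ℝ) + 1) * φ)) - A - r * (Real.cos (r * φ) * r / Real.sin (r * φ))
      = -((A - r * B) ^ 2 + (r + 1) ^ 2) / (A + B) := by
    rw [hsin, hcos, mul_div_right_comm (Real.cos (r * φ)), ← hB]
    field_simp
    ring
  rw [hkey]
  exact div_neg_of_neg_of_pos (by nlinarith [sq_nonneg (A - r * B)]) hAB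

theorem strictAntiOn_rhoExt {r : ℕ} (hr : 1 ≤ r) :
    StrictAntiOn (rhoExt r) (Set.Icc 0 (Real.pi / ((r : ℝ) + 1))) := by
  refine strictAntiOn_of_deriv_neg (convex_Icc _ _) (continuousOn_rhoExt hr) fun φ hφ => ?_
  rw [interior_Icc] at hφ
  exact deriv_rhoExt_neg hr hφ

theorem strictAntiOn_rho {r : ℕ} (hr : 1 ≤ r) : StrictAntiOn (rho r) (paramInterval r) :=
  ((strictAntiOn_rhoExt hr).mono Set.Ioo_subset_Icc_self).congr fun _ hφ => rhoExt_eq hr hφ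

theorem bijOn_rho {r : ℕ} (hr : 1 ≤ r) :
    Set.BijOn (rho r) (paramInterval r) (Set.Ioo 0 (xStar r)) := by
  have h := (continuousOn_rhoExt hr).image_Ioo_of_strictAntiOn (pi_div_pos r).le
    (strictAntiOn_rhoExt hr)
  rw [rhoExt_zero hr, rhoExt_right hr] at h
  rw [← h, Set.image_congr (s := Set.Ioo 0 _) fun φ hφ => rhoExt_eq hr hφ]
  exact (strictAntiOn_rho hr).injOn.bijOn_image

/-- The derivative of `f`, written as a sum of squares. -/
def weight (r : ℕ) (φ : ℝ) : ℝ :=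
  (Real.cos φ - r * Real.cos (r * φ) * sinQuot r φ) ^ 2 + (r + 1) ^ 2 * Real.sin φ ^ 2

theorem weight_nonneg (r : ℕ) (φ : ℝ) : 0 ≤ weight r φ := by
  unfold weight
  positivity

@[fun_prop]
theorem measurable_weight (r : ℕ) : Measurable (weight r) := by
  unfold weight
  fun_prop

@[fun_prop]
theorem measurable_rho (r : ℕ) : Measurable (rho r) := by
  unfold rho
  fun_prop

theorem continuousOn_weight {r : ℕ} (hr : 1 ≤ r) :
    ContinuousOn (weight r) (Set.Icc 0 (Real.pi / ((r : ℝ) + 1))) := by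
  have := continuousOn_sinQuot hr
  unfold weight
  fun_prop

/-- The curve `u(φ) = (sin φ / sin (r φ)) e ^ {i (r + 1) φ}` in the upper half plane, on which
`(1 + u) ^ (r + 1) / u` is real and equal to `ρ(φ)`. It runs from `1 / r` to `-1`. -/
def curve (r : ℕ) (φ : ℝ) : ℂ := sinQuot r φ * Complex.exp ((((r : ℝ) + 1) * φ : ℝ) * Complex.I)

theorem curve_zero (r : ℕ) : curve r 0 = (((r : ℝ)⁻¹ : ℝ) : ℂ) := by
  simp [curve, sinQuot_zero]

theorem curve_right {r : ℕ} (hr : 1 ≤ r) :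
    curve r (Real.pi / ((r : ℝ) + 1)) = ((-1 : ℝ) : ℂ) := by
  rw [curve, sinQuot_right hr, mul_div_cancel₀ _ (by positivity), Complex.exp_pi_mul_I]
  simp

theorem curve_ne_zero {r : ℕ} (hr : 1 ≤ r) {φ : ℝ}
    (hφ : φ ∈ Set.Icc 0 (Real.pi / ((r : ℝ) + 1))) : curve r φ ≠ 0 :=
  mul_ne_zero (by exact_mod_cast (sinQuot_pos hr hφ).ne') (Complex.exp_ne_zero _)

theorem continuousOn_curve {r : ℕ} (hr : 1 ≤ r) :
    ContinuousOn (curve r) (Set.Icc 0 (Real.pi / ((r : ℝ) + 1))) := by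
  have := continuousOn_sinQuot hr
  unfold curve
  fun_prop

/-- Here `1 + u = (sin ((r + 1) φ) / sin (r φ)) e ^ {i φ}`. -/
theorem one_add_curve_pow {r : ℕ} (hr : 1 ≤ r) {φ : ℝ} (hφ : φ ∈ paramInterval r) :
    (1 + curve r φ) ^ (r + 1) = rho r φ * curve r φ := by
  obtain ⟨h1, h2⟩ := sin_pos_of_mem hr ⟨hφ.1, hφ.2.le⟩
  have hS := sinQuot_eq hr ⟨hφ.1, hφ.2.le⟩
  have h4 : 1 + curve r φ = ((Real.sin (((r : ℝ) + 1) * φ) / Real.sin (r * φ) : ℝ) : ℂ)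
      * Complex.exp (φ * Complex.I) := by
    rw [curve, hS, Complex.exp_mul_I, Complex.exp_mul_I, ← Complex.ofReal_cos,
      ← Complex.ofReal_sin, ← Complex.ofReal_cos, ← Complex.ofReal_sin]
    have hsq := Real.sin_sq_add_cos_sq φ
    apply Complex.ext
    · simp only [Complex.add_re, Complex.one_re, Complex.re_ofReal_mul, Complex.ofReal_re,
        Complex.mul_I_re, Complex.ofReal_im, neg_zero, add_zero]
      rw [add_one_mul, Real.sin_add, Real.cos_add]
      field_simp
      linear_combination (-Real.sin (r * φ)) * hsq
    · simp only [Complex.add_im, Complex.one_im, Complex.im_ofReal_mul, Complex.ofReal_re,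
        Complex.mul_I_im, Complex.ofReal_im, zero_add]
      ring
  have h5 : ((Real.sin (((r : ℝ) + 1) * φ) / Real.sin (r * φ)) ^ (r + 1) : ℝ)
      = rho r φ * sinQuot r φ := by
    rw [hS, rho, div_pow, pow_succ (Real.sin (r * φ))]
    field_simp
  rw [h4, mul_pow, ← Complex.ofReal_pow, h5, ← Complex.exp_nat_mul, curve]
  push_cast
  ring_nf

/-- The logarithmic derivative of the curve is `cot φ - r cot (r φ) + i (r + 1)`. -/
theorem hasDerivAt_curve {r : ℕ} (hr : 1 ≤ r) {φ : ℝ} (hφ : φ ∈ paramInterval r) :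
    HasDerivAt (curve r) (curve r φ *
      ((Real.cos φ / Real.sin φ - r * (Real.cos (r * φ) / Real.sin (r * φ)) : ℝ) +
        ((r : ℝ) + 1 : ℝ) * Complex.I)) φ := by
  obtain ⟨h1, h2⟩ := sin_pos_of_mem hr ⟨hφ.1, hφ.2.le⟩
  have heq : sinQuot r =ᶠ[𝓝 φ] fun φ => Real.sin φ / Real.sin (r * φ) := by
    filter_upwards [isOpen_Ioo.mem_nhds hφ] with θ hθ using sinQuot_eq hr ⟨hθ.1, hθ.2.le⟩
  have hS : HasDerivAt (sinQuot r) (sinQuot r φ *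
      (Real.cos φ / Real.sin φ - r * (Real.cos (r * φ) / Real.sin (r * φ)))) φ := by
    refine (((Real.hasDerivAt_sin φ).div (hasDerivAt_sin_mul r φ) h2.ne').congr_of_eventuallyEq
      heq).congr_deriv ?_
    rw [sinQuot_eq hr ⟨hφ.1, hφ.2.le⟩]
    field_simp
  have hlin : HasDerivAt (fun φ : ℝ => ((((r : ℝ) + 1) * φ : ℝ) : ℂ) * Complex.I)
      (((r : ℝ) + 1 : ℝ) * Complex.I) φ := by
    have h : HasDerivAt (fun φ : ℝ => ((r : ℝ) + 1) * φ) ((r : ℝ) + 1) φ := by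
      simpa using (hasDerivAt_id φ).const_mul ((r : ℝ) + 1)
    exact h.ofReal_comp.mul_const _
  refine (hS.ofReal_comp.mul hlin.cexp).congr_deriv ?_
  rw [curve]
  push_cast
  ring

/-- The identity `Im ((1 / u - r) du/dφ) = f'`. -/
theorem im_one_sub_mul_curve_mul {r : ℕ} (hr : 1 ≤ r) {φ : ℝ} (hφ : φ ∈ paramInterval r) :
    ((1 - r * curve r φ) *
      ((Real.cos φ / Real.sin φ - r * (Real.cos (r * φ) / Real.sin (r * φ)) : ℝ) +
        ((r : ℝ) + 1 : ℝ) * Complex.I)).im = weight r φ := by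
  obtain ⟨h1, h2⟩ := sin_pos_of_mem hr ⟨hφ.1, hφ.2.le⟩
  have hre : (curve r φ).re = sinQuot r φ * Real.cos (((r : ℝ) + 1) * φ) := by
    rw [curve, Complex.re_ofReal_mul, Complex.exp_ofReal_mul_I_re]
  have him : (curve r φ).im = sinQuot r φ * Real.sin (((r : ℝ) + 1) * φ) := by
    rw [curve, Complex.im_ofReal_mul, Complex.exp_ofReal_mul_I_im]
  have hr1 : (1 - r * curve r φ).re = 1 - r * (curve r φ).re := by simp
  have hr2 : (1 - r * curve r φ).im = - (r * (curve r φ).im) := by simp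
  rw [Complex.mul_im, hr1, hr2, hre, him, weight, sinQuot_eq hr ⟨hφ.1, hφ.2.le⟩, add_one_mul (r : ℝ),
    Real.sin_add, Real.cos_add]
  simp only [Complex.add_im, Complex.add_re, Complex.ofReal_re, Complex.ofReal_im, Complex.mul_im,
    Complex.mul_re, Complex.I_re, Complex.I_im, mul_zero, mul_one, zero_add, add_zero, sub_zero]
  have hsq := Real.sin_sq_add_cos_sq φ
  generalize Real.sin (r * φ) = s at *
  generalize Real.cos (r * φ) = c at *
  generalize Real.sin φ = s₁ at *
  generalize Real.cos φ = c₁ at *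
  field_simp
  linear_combination (-((r : ℝ) + 1) * s ^ 2) * hsq

/-! ### Primitives of `ρ ^ k f'` -/

/-- The polynomial `(1 + u) ^ ((r + 1) k) (1 - r u)`. Its coefficient of `u ^ k` is the `k`-th
Fuss–Catalan number. -/
def momentPoly (r k : ℕ) : ℝ[X] := (1 + X) ^ ((r + 1) * k) * (1 - C (r : ℝ) * X)

theorem natDegree_momentPoly_lt (r k : ℕ) : (momentPoly r k).natDegree < (r + 1) * k + 2 := by
  have h : (momentPoly r k).natDegree ≤ (r + 1) * k * 1 + 1 := by
    unfold momentPoly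
    refine natDegree_mul_le_of_le (natDegree_pow_le_of_le _ ?_) ?_ <;> compute_degree
  omega

theorem coeff_momentPoly (r k : ℕ) :
    (momentPoly r k).coeff k = ((r * k + k).choose k : ℝ) / ((r : ℝ) * k + 1) := by
  have h1 : momentPoly r k =
      (1 + X) ^ ((r + 1) * k) - C (r : ℝ) * ((1 + X) ^ ((r + 1) * k) * X) := by
    rw [momentPoly]
    ring
  rw [h1, coeff_sub, coeff_C_mul, coeff_one_add_X_pow]
  cases k with
  | zero => simp
  | succ m =>
    rw [coeff_mul_X, coeff_one_add_X_pow, show r * (m + 1) + (m + 1) = (r + 1) * (m + 1) by ring]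
    have h2 := Nat.choose_succ_right_eq ((r + 1) * (m + 1)) m
    have h3 : (r + 1) * (m + 1) - m = r * (m + 1) + 1 := by
      rw [Nat.sub_eq_iff_eq_add (by nlinarith)]
      ring
    rw [h3] at h2
    have h4 : (((r + 1) * (m + 1)).choose (m + 1) : ℝ) * (m + 1)
        = ((r + 1) * (m + 1)).choose m * (r * (m + 1) + 1) := by exact_mod_cast h2
    have h5 : (r : ℝ) * (m + 1) + 1 ≠ 0 := by positivity
    push_cast
    rw [eq_div_iff h5]
    linear_combination (r : ℝ) * h4

/-- A primitive of `ρ ^ k f'`: the imaginary part of the primitive of the Laurent polynomial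
`u ^ {-k-1} (1 + u) ^ ((r + 1) k) (1 - r u)` along the curve, where the residue term `log u` has
imaginary part `(r + 1) φ`. -/
def momentPrimitive (r k : ℕ) (φ : ℝ) : ℝ :=
  ∑ j ∈ Finset.range ((r + 1) * k + 2), (momentPoly r k).coeff j *
    if j = k then ((r : ℝ) + 1) * φ
    else (curve r φ ^ ((j : ℤ) - k)).im / ((j : ℝ) - k)

theorem continuousOn_momentPrimitive {r : ℕ} (hr : 1 ≤ r) (k : ℕ) :
    ContinuousOn (momentPrimitive r k) (Set.Icc 0 (Real.pi / ((r : ℝ) + 1))) := by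
  refine continuousOn_finsetSum _ fun j _ => ContinuousOn.mul continuousOn_const ?_
  split_ifs
  · fun_prop
  · refine ContinuousOn.div_const (Complex.continuous_im.comp_continuousOn ?_) _
    exact (continuousOn_curve hr).zpow₀ _ fun φ hφ => Or.inl (curve_ne_zero hr hφ)

/-- Where the curve meets the real axis, only the residue term remains. -/
theorem momentPrimitive_of_curve_real {r k : ℕ} {φ x : ℝ} (h : curve r φ = (x : ℂ)) :
    momentPrimitive r k φ = (momentPoly r k).coeff k * (((r : ℝ) + 1) * φ) := by
  rw [momentPrimitive, Finset.sum_eq_single k]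
  · simp
  · intro j _ hj
    rw [if_neg hj, h, ← Complex.ofReal_zpow, Complex.ofReal_im]
    simp
  · intro hk
    rw [coeff_eq_zero_of_natDegree_lt, zero_mul]
    have := natDegree_momentPoly_lt r k
    simp only [Finset.mem_range, not_lt] at hk
    omega

theorem momentPrimitive_zero (r k : ℕ) : momentPrimitive r k 0 = 0 := by
  rw [momentPrimitive_of_curve_real (curve_zero r)]
  simp

theorem momentPrimitive_right {r : ℕ} (hr : 1 ≤ r) (k : ℕ) :
    momentPrimitive r k (Real.pi / ((r : ℝ) + 1)) = (momentPoly r k).coeff k * Real.pi := by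
  rw [momentPrimitive_of_curve_real (curve_right hr), mul_div_cancel₀ _ (by positivity)]

theorem f_eq_momentPrimitive {r : ℕ} (hr : 1 ≤ r) {φ : ℝ} (hφ : φ ∈ paramInterval r) :
    f r φ = momentPrimitive r 0 φ := by
  have him : (curve r φ).im = sinQuot r φ * Real.sin (((r : ℝ) + 1) * φ) := by
    rw [curve, Complex.im_ofReal_mul, Complex.exp_ofReal_mul_I_im]
  simp [momentPrimitive, Finset.sum_range_succ, momentPoly, f, him,
    sinQuot_eq hr ⟨hφ.1, hφ.2.le⟩, coeff_one]
  ring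

theorem hasDerivAt_momentPrimitive {r : ℕ} (hr : 1 ≤ r) (k : ℕ) {φ : ℝ}
    (hφ : φ ∈ paramInterval r) :
    HasDerivAt (momentPrimitive r k) (rhoExt r φ ^ k * weight r φ) φ := by
  have hu := hasDerivAt_curve hr hφ
  have hu0 := curve_ne_zero hr (Set.Ioo_subset_Icc_self hφ)
  have hw := im_one_sub_mul_curve_mul hr hφ
  set c : ℂ := ((Real.cos φ / Real.sin φ - r * (Real.cos (r * φ) / Real.sin (r * φ)) : ℝ) +
        ((r : ℝ) + 1 : ℝ) * Complex.I) with hc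
  have hcim : c.im = (r : ℝ) + 1 := by
    rw [hc, Complex.add_im, Complex.ofReal_im, Complex.im_ofReal_mul, Complex.I_im]
    ring
  have hterm : ∀ j : ℕ, HasDerivAt (fun φ : ℝ => if j = k then ((r : ℝ) + 1) * φ
      else (curve r φ ^ ((j : ℤ) - k)).im / ((j : ℝ) - k))
      (curve r φ ^ ((j : ℤ) - k) * c).im φ := by
    intro j
    by_cases hj : j = k
    · subst hj
      simpa [hcim] using (hasDerivAt_id φ).const_mul ((r : ℝ) + 1)
    · simp only [if_neg hj]
      have hjk : ((j : ℝ) - k) ≠ 0 := sub_ne_zero.2 (by exact_mod_cast hj)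
      have h1 := (hasDerivAt_zpow ((j : ℤ) - k) (curve r φ) (Or.inl hu0)).comp φ hu
      have h2 := (Complex.imCLM.hasFDerivAt.comp_hasDerivAt φ h1).div_const ((j : ℝ) - k)
      refine h2.congr_deriv ?_
      rw [Complex.imCLM_apply, mul_assoc, ← mul_assoc (_ ^ _), zpow_sub_one₀ hu0,
        inv_mul_cancel_right₀ hu0,
        show ((((j : ℤ) - k : ℤ) : ℂ)) = (((j : ℝ) - k : ℝ) : ℂ) by push_cast; ring,
        Complex.im_ofReal_mul]
      field_simp
  have hsum := HasDerivAt.fun_sum (u := Finset.range ((r + 1) * k + 2)) fun j _ =>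
    (hterm j).const_mul ((momentPoly r k).coeff j)
  refine hsum.congr_deriv ?_
  -- By `(1 + u) ^ (r + 1) = ρ u`, the Laurent polynomial equals `ρ ^ k (1 - r u)` on the curve.
  have hpoly : ∑ j ∈ Finset.range ((r + 1) * k + 2),
      (((momentPoly r k).coeff j : ℝ) : ℂ) * (curve r φ ^ ((j : ℤ) - k) * c)
      = ((rho r φ ^ k : ℝ) : ℂ) * ((1 - r * curve r φ) * c) := by
    have h1 := aeval_eq_sum_range' (natDegree_momentPoly_lt r k) (curve r φ)
    have h2 : aeval (curve r φ) (momentPoly r k)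
        = (rho r φ * curve r φ) ^ k * (1 - r * curve r φ) := by
      rw [← one_add_curve_pow hr hφ, ← pow_mul]
      simp [momentPoly]
    rw [h2] at h1
    have h3 : ∀ j : ℕ, curve r φ ^ ((j : ℤ) - k) = curve r φ ^ j * (curve r φ ^ k)⁻¹ := by
      intro j
      rw [zpow_sub₀ hu0, zpow_natCast, zpow_natCast, div_eq_mul_inv]
    have h4 : ∑ j ∈ Finset.range ((r + 1) * k + 2),
        (((momentPoly r k).coeff j : ℝ) : ℂ) * (curve r φ ^ ((j : ℤ) - k) * c)
        = (∑ j ∈ Finset.range ((r + 1) * k + 2),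
          (momentPoly r k).coeff j • curve r φ ^ j) * ((curve r φ ^ k)⁻¹ * c) := by
      rw [Finset.sum_mul]
      refine Finset.sum_congr rfl fun j _ => ?_
      rw [h3, Complex.real_smul]
      ring
    rw [h4, ← h1, mul_pow]
    have : curve r φ ^ k ≠ 0 := pow_ne_zero _ hu0
    push_cast
    field_simp
  have := congrArg Complex.im hpoly
  rw [Complex.im_sum, Complex.im_ofReal_mul, hw] at this
  rw [rhoExt_eq hr hφ, ← this]
  exact Finset.sum_congr rfl fun j _ => (Complex.im_ofReal_mul _ _).symm

theorem integral_rhoExt_pow_mul_weight {r : ℕ} (hr : 1 ≤ r) (k : ℕ) {a : ℝ} (ha : 0 ≤ a)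
    (ha' : a ≤ Real.pi / ((r : ℝ) + 1)) :
    IntervalIntegrable (fun φ => rhoExt r φ ^ k * weight r φ) volume a (Real.pi / ((r : ℝ) + 1)) ∧
    ∫ φ in a..(Real.pi / ((r : ℝ) + 1)), rhoExt r φ ^ k * weight r φ =
      (momentPoly r k).coeff k * Real.pi - momentPrimitive r k a := by
  have hsub : Set.Icc a (Real.pi / ((r : ℝ) + 1)) ⊆ Set.Icc 0 (Real.pi / ((r : ℝ) + 1)) :=
    Set.Icc_subset_Icc_left ha
  have hint : IntervalIntegrable (fun φ => rhoExt r φ ^ k * weight r φ) volume a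
      (Real.pi / ((r : ℝ) + 1)) := by
    refine ContinuousOn.intervalIntegrable ?_
    rw [Set.uIcc_of_le ha']
    exact (((continuousOn_rhoExt hr).pow k).mul (continuousOn_weight hr)).mono hsub
  refine ⟨hint, ?_⟩
  rw [intervalIntegral.integral_eq_sub_of_hasDerivAt_of_le ha'
    ((continuousOn_momentPrimitive hr k).mono hsub)
    (fun φ hφ => hasDerivAt_momentPrimitive hr k ⟨ha.trans_lt hφ.1, hφ.2⟩) hint,
    momentPrimitive_right hr]

/-! ### The Fuss–Catalan distribution -/

/-- The law of the angle: the measure on `(0, π / (r + 1))` with density `f' / π`. -/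
def angleMeasure (r : ℕ) : Measure ℝ :=
  (volume.restrict (paramInterval r)).withDensity fun φ => ENNReal.ofReal (weight r φ / Real.pi)

theorem ae_mem_paramInterval (r : ℕ) : ∀ᵐ φ ∂(angleMeasure r), φ ∈ paramInterval r :=
  (withDensity_absolutelyContinuous _ _).ae_le (ae_restrict_mem measurableSet_Ioo)

theorem moment_angleMeasure {r : ℕ} (hr : 1 ≤ r) (k : ℕ) :
    Integrable (fun φ => rho r φ ^ k) (angleMeasure r) ∧
      ∫ φ, rho r φ ^ k ∂(angleMeasure r) = (momentPoly r k).coeff k := by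
  have hmeas : Measurable fun φ => ENNReal.ofReal (weight r φ / Real.pi) := by fun_prop
  have hfin : ∀ᵐ φ ∂(volume.restrict (paramInterval r)),
      ENNReal.ofReal (weight r φ / Real.pi) < ⊤ := ae_of_all _ fun _ => ENNReal.ofReal_lt_top
  have hae : (fun φ => (ENNReal.ofReal (weight r φ / Real.pi)).toReal • rho r φ ^ k)
      =ᵐ[volume.restrict (paramInterval r)]
      fun φ => Real.pi⁻¹ * (rhoExt r φ ^ k * weight r φ) := by
    filter_upwards [ae_restrict_mem measurableSet_Ioo] with φ hφ
    rw [ENNReal.toReal_ofReal (div_nonneg (weight_nonneg r φ) Real.pi_pos.le), rhoExt_eq hr hφ,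
      smul_eq_mul]
    ring
  obtain ⟨h1, h2⟩ := integral_rhoExt_pow_mul_weight hr k le_rfl (pi_div_pos r).le
  rw [intervalIntegrable_iff_integrableOn_Ioo_of_le (pi_div_pos r).le] at h1
  rw [intervalIntegral.integral_of_le (pi_div_pos r).le, integral_Ioc_eq_integral_Ioo,
    momentPrimitive_zero, sub_zero] at h2
  constructor
  · rw [angleMeasure, integrable_withDensity_iff_integrable_smul' hmeas hfin, integrable_congr hae]
    exact h1.const_mul _
  · rw [angleMeasure, integral_withDensity_eq_integral_toReal_smul hmeas hfin,
      integral_congr_ae hae, integral_const_mul, paramInterval, h2]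
    have := Real.pi_ne_zero
    field_simp

theorem real_angleMeasure_Ico {r : ℕ} (hr : 1 ≤ r) {a : ℝ} (ha : a ∈ paramInterval r) :
    (angleMeasure r).real (Set.Ico a (Real.pi / ((r : ℝ) + 1))) = 1 - 1 / Real.pi * f r a := by
  have hnn : ∀ φ, 0 ≤ weight r φ / Real.pi := fun φ =>
    div_nonneg (weight_nonneg r φ) Real.pi_pos.le
  obtain ⟨h1, h2⟩ := integral_rhoExt_pow_mul_weight hr 0 ha.1.le ha.2.le
  have hsub : Set.Ico a (Real.pi / ((r : ℝ) + 1)) ∩ paramInterval r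
      = Set.Ico a (Real.pi / ((r : ℝ) + 1)) :=
    Set.inter_eq_left.2 fun φ hφ => ⟨ha.1.trans_le hφ.1, hφ.2⟩
  rw [intervalIntegrable_iff_integrableOn_Ico_of_le ha.2.le] at h1
  rw [intervalIntegral.integral_of_le ha.2.le, integral_Ioc_eq_integral_Ioo,
    ← integral_Ico_eq_integral_Ioo, ← f_eq_momentPrimitive hr ha] at h2
  simp only [pow_zero, one_mul, coeff_momentPoly] at h1 h2
  rw [Measure.real, angleMeasure, withDensity_apply _ measurableSet_Ico, Measure.restrict_restrict
    measurableSet_Ico, hsub, ← ofReal_integral_eq_lintegral_ofReal (h1.div_const _)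
      (ae_of_all _ hnn), ENNReal.toReal_ofReal (integral_nonneg hnn), integral_div, h2]
  have := Real.pi_ne_zero
  simp
  field_simp

/-- The Fuss–Catalan distribution, as the law of `ρ(φ)` for the random angle `φ`. -/
def fussCatalanMeasure (r : ℕ) : Measure ℝ := (angleMeasure r).map (rho r)

theorem moment_fussCatalanMeasure {r : ℕ} (hr : 1 ≤ r) (k : ℕ) :
    Integrable (fun x : ℝ => x ^ k) (fussCatalanMeasure r) ∧
      ∫ x, x ^ k ∂(fussCatalanMeasure r) = ((r * k + k).choose k : ℝ) / ((r : ℝ) * k + 1) := by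
  obtain ⟨h1, h2⟩ := moment_angleMeasure hr k
  have hm : AEStronglyMeasurable (fun x : ℝ => x ^ k) ((angleMeasure r).map (rho r)) := by
    fun_prop
  rw [← coeff_momentPoly, ← h2]
  exact ⟨(integrable_map_measure hm (measurable_rho r).aemeasurable).2 h1,
    integral_map (measurable_rho r).aemeasurable hm⟩

theorem isProbabilityMeasure_fussCatalanMeasure {r : ℕ} (hr : 1 ≤ r) :
    IsProbabilityMeasure (fussCatalanMeasure r) := by
  obtain ⟨h1, h2⟩ := moment_fussCatalanMeasure hr 0
  simp only [pow_zero] at h1 h2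
  have := (integrable_const_iff_isFiniteMeasure (one_ne_zero : (1 : ℝ) ≠ 0)).1 h1
  refine ⟨?_⟩
  rw [integral_const] at h2
  rw [← ENNReal.ofReal_toReal (measure_ne_top (fussCatalanMeasure r) Set.univ)]
  simp [Measure.real] at h2
  simp [h2]

theorem ae_mem_fussCatalanMeasure {r : ℕ} (hr : 1 ≤ r) :
    ∀ᵐ x ∂(fussCatalanMeasure r), x ∈ Set.Ioo 0 (xStar r) := by
  rw [fussCatalanMeasure, ae_map_iff (p := fun x => x ∈ Set.Ioo 0 (xStar r))
    (measurable_rho r).aemeasurable measurableSet_Ioo]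
  exact (ae_mem_paramInterval r).mono fun φ hφ => (bijOn_rho hr).mapsTo hφ

theorem integral_pow_fussCatalanMeasure_le {r : ℕ} (hr : 1 ≤ r) (k : ℕ) :
    ∫ x, x ^ k ∂(fussCatalanMeasure r) ≤ xStar r ^ k := by
  have := isProbabilityMeasure_fussCatalanMeasure hr
  calc ∫ x, x ^ k ∂(fussCatalanMeasure r) ≤ ∫ _x, xStar r ^ k ∂(fussCatalanMeasure r) :=
        integral_mono_ae (moment_fussCatalanMeasure hr k).1 (integrable_const _)
          ((ae_mem_fussCatalanMeasure hr).mono fun x hx => pow_le_pow_left₀ hx.1.le hx.2.le k)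
    _ = xStar r ^ k := by simp

theorem cdf_fussCatalanMeasure {r : ℕ} (hr : 1 ≤ r) (x : ℝ) :
    cdf (fussCatalanMeasure r) x = V r x := by
  have := isProbabilityMeasure_fussCatalanMeasure hr
  have hae := ae_mem_fussCatalanMeasure hr
  rw [cdf_eq_real, V, Measure.real]
  split_ifs with h0 h1
  · rw [measure_eq_zero_iff_ae_notMem.2, ENNReal.toReal_zero]
    exact hae.mono fun y hy hyx => absurd (lt_of_lt_of_le hy.1 hyx) (not_lt.2 h0)
  · have hx : x ∈ Set.Ioo 0 (xStar r) := ⟨not_le.1 h0, h1⟩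
    have hmem : rhoInv r x ∈ paramInterval r := (bijOn_rho hr).surjOn.mapsTo_invFunOn hx
    have hval : rho r (rhoInv r x) = x := (bijOn_rho hr).surjOn.rightInvOn_invFunOn hx
    have hset : angleMeasure r (rho r ⁻¹' Set.Iic x)
        = angleMeasure r (Set.Ico (rhoInv r x) (Real.pi / ((r : ℝ) + 1))) := by
      refine measure_congr ((ae_mem_paramInterval r).mono fun φ hφ => propext ?_)
      have h := (strictAntiOn_rho hr).le_iff_ge hφ hmem
      rw [hval] at h
      exact h.trans (and_iff_left hφ.2).symm
    rw [fussCatalanMeasure, Measure.map_apply (measurable_rho r) measurableSet_Iic, hset,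
      ← Measure.real, real_angleMeasure_Ico hr hmem]
  · rw [prob_compl_eq_zero_iff measurableSet_Iic |>.1, ENNReal.toReal_one]
    exact measure_eq_zero_iff_ae_notMem.2
      (hae.mono fun y hy hyx => hyx (hy.2.le.trans (not_lt.1 h1)))

/-! ### Weak convergence of the zero counting measures -/

/-- The zero counting measures as probability measures. For `n = 0` the polynomial has no zeros,
and a Dirac mass takes the place of the zero measure. -/
def zeroMeasure (r : ℕ) (ν : Fin r → ℕ) (n : ℕ) : ProbabilityMeasure ℝ :=
  if hn : 1 ≤ n then
    ⟨zeroCountingMeasure (scaledF r ν n),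
      isProbabilityMeasure_zeroCountingMeasure (splits_scaledF r ν n)
        (by rw [natDegree_scaledF r ν hn]; omega)⟩
  else ⟨Measure.dirac 0, inferInstance⟩

theorem coe_zeroMeasure (r : ℕ) (ν : Fin r → ℕ) {n : ℕ} (hn : 1 ≤ n) :
    (zeroMeasure r ν n : Measure ℝ) = zeroCountingMeasure (scaledF r ν n) :=
  congrArg Subtype.val (dif_pos hn)

theorem integrable_zeroMeasure (r : ℕ) (ν : Fin r → ℕ) (n : ℕ) (g : ℝ → ℝ) :
    Integrable g (zeroMeasure r ν n : Measure ℝ) := by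
  by_cases hn : 1 ≤ n
  · rw [coe_zeroMeasure r ν hn]
    exact integrable_zeroCountingMeasure (by rw [natDegree_scaledF r ν hn]; omega) g
  · rw [show (zeroMeasure r ν n : Measure ℝ) = Measure.dirac 0 from
      congrArg Subtype.val (dif_neg hn)]
    exact integrable_dirac (by simp)

end GinibreZeros

end

theorem theorem3p4 (r : ℕ) (hr : 1 ≤ r) (ν : Fin r → ℕ) :
    -- `ρ` is a bijection between the two open intervals, so that `ρ⁻¹` is meaningful
    Set.BijOn (GinibreZeros.rho r) (GinibreZeros.paramInterval r)
      (Set.Ioo 0 (GinibreZeros.xStar r)) ∧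
    ∃ (μn : ℕ → ProbabilityMeasure ℝ) (μ : ProbabilityMeasure ℝ),
      -- for `n ≥ 1`, `μn n` is the normalized zero counting measure of `F_n(n^r x)`
      (∀ n : ℕ, 1 ≤ n → (μn n : Measure ℝ) =
        GinibreZeros.zeroCountingMeasure (GinibreZeros.scaledF r ν n)) ∧
      -- weak-star convergence
      Tendsto μn atTop (𝓝 μ) ∧
      -- the limit is carried by `[0, (r+1)^(r+1)/r^r]` and has distribution function `V`
      (μ : Measure ℝ) (Set.Icc 0 (GinibreZeros.xStar r))ᶜ = 0 ∧
      (∀ x : ℝ, cdf (μ : Measure ℝ) x = GinibreZeros.V r x) ∧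
      -- the limit is the Fuss-Catalan distribution of order `r`, which is unique
      (∀ m : ProbabilityMeasure ℝ, GinibreZeros.IsFussCatalan r m ↔ m = μ) := by
  have hprob := GinibreZeros.isProbabilityMeasure_fussCatalanMeasure hr
  have hmom := GinibreZeros.moment_fussCatalanMeasure hr
  have hbound := GinibreZeros.integral_pow_fussCatalanMeasure_le hr
  refine ⟨GinibreZeros.bijOn_rho hr, GinibreZeros.zeroMeasure r ν,
    ⟨GinibreZeros.fussCatalanMeasure r, hprob⟩, fun n hn => GinibreZeros.coe_zeroMeasure r ν hn,
    ?_, ?_, GinibreZeros.cdf_fussCatalanMeasure hr, fun m => ⟨fun hm => ?_, ?_⟩⟩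
  · refine GinibreZeros.tendsto_of_tendsto_moments
      (fun n k => GinibreZeros.integrable_zeroMeasure r ν n _) (fun k => (hmom k).1) hbound
      fun k => ?_
    have h := GinibreZeros.tendsto_moments_zeroCountingMeasure r ν k
    rw [← (hmom k).2] at h
    refine h.congr' ((eventually_ge_atTop 1).mono fun n hn => ?_)
    beta_reduce
    rw [GinibreZeros.coe_zeroMeasure r ν hn]
  · exact measure_eq_zero_iff_ae_notMem.2 ((GinibreZeros.ae_mem_fussCatalanMeasure hr).mono
      fun x hx hx' => hx' (Set.Ioo_subset_Icc_self hx))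
  -- Uniqueness: a constant sequence with the right moments converges to the limit.
  · refine tendsto_nhds_unique (tendsto_const_nhds (x := m) (f := (atTop : Filter ℕ))) ?_
    refine GinibreZeros.tendsto_of_tendsto_moments (fun _ k => (hm k).1) (fun k => (hmom k).1)
      hbound fun k => ?_
    rw [(hm k).2]
    exact (hmom k).2 ▸ tendsto_const_nhds
  · rintro rfl
    exact hmom
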